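/- Let $t\in[0,1]$. For $n\ge 1$, let $A_{n,t}$ be a random $n\times n$ matrix from the Elliptic Ginibre Ensemble, i.e. with the law of $$\sqrt{\tfrac{1+t}{2}}\,X_n+i\sqrt{\tfrac{1-t}{2}}\,Y_n ,$$ where $X_n,Y_n$ are independent matrices from the Gaussian Unitary Ensemble of size $n$, normalised so that the diagonal entries are real $N(0,1)$ variables and the entries above the diagonal are standard complex Gaussians ($\mathbb E[x^2]=0$, $\mathbb E|x|^2=1$), all of them independent. Let the modified Chebyshev polynomials be defined by $P^{(t)}_0=2$, $P^{(t)}_1=X$, $P^{(t)}_{k+1}=XP^{(t)}_k-tP^{(t)}_{k-1}$ for $k\ge1$, and for $k\ge 0$ put $$U^{(n)}_{k,t}=\mathrm{Tr}\Big[P^{(t)}_k\Big(\tfrac{A_{n,t}}{\sqrt n}\Big)\Big]+nt\,\delta_{k=2},\qquad V^{(n)}_{k,t}=U^{(n)}_{k,t}-\mathbb E\big[U^{(n)}_{k,t}\big].$$ Then all the $U^{(n)}_{k,t}$ are integrable and, as $n\to\infty$, the family $(V^{(n)}_{k,t})_{k\ge0}$ converges in law (jointly in $k$, as random elements of $\mathbb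 C^{\mathbb N}$ with the product topology) to a family $(V_{k,t})_{k\ge0}$ of independent centred complex Gaussian random variables (each $V_{k,t}$ being possibly degenerate, with $(\mathrm{Re}\,V_{k,t},\mathrm{Im}\,V_{k,t})$ jointly Gaussian) such that $\mathbb E[V_{k,t}^2]=kt^k$ and $\mathbb E[|V_{k,t}|^2]=k$ for all $k\ge 0$. -/

import Mathlib

open MeasureTheory ProbabilityTheory Filter

/-- The modified Chebyshev polynomials `P_k^{(t)}`, i.e. `P_0 = 2`, `P_1 = X` and
`P_{k+2} = X P_{k+1} - t P_k`. These are the Dickson polynomials of the first kind with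
parameter `t`; the recurrence is recorded in the three lemmas below. -/
noncomputable def modChebyshev (t : ℝ) (k : ℕ) : Polynomial ℂ :=
  Polynomial.dickson 1 (t : ℂ) k

theorem modChebyshev_zero (t : ℝ) : modChebyshev t 0 = 2 := by
  unfold modChebyshev
  rw [Polynomial.dickson_zero]
  norm_num

theorem modChebyshev_one (t : ℝ) : modChebyshev t 1 = Polynomial.X := by
  unfold modChebyshev
  rw [Polynomial.dickson_one]

theorem modChebyshev_add_two (t : ℝ) (k : ℕ) :
    modChebyshev t (k + 2) =
      Polynomial.X * modChebyshev t (k + 1) - Polynomial.C (t : ℂ) * modChebyshev t k := by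
  unfold modChebyshev
  rw [Polynomial.dickson_add_two]

/-- Matrices carry the product sigma-algebra of their entries. -/
instance instMeasurableSpaceMatrix {m n α : Type*} [MeasurableSpace α] :
    MeasurableSpace (Matrix m n α) :=
  inferInstanceAs (MeasurableSpace (m → n → α))

/-- The Hermitian matrix with diagonal entries `g i i` and, above the diagonal, entries
`(g i j + i g j i) / √2`. -/
noncomputable def gueMatrix (n : ℕ) (g : Fin n × Fin n → ℝ) : Matrix (Fin n) (Fin n) ℂ :=
  Matrix.of fun i j =>
    if i = j then (g (i, i) : ℂ)
    else if i < j then ((g (i, j) : ℂ) + Complex.I * (g (j, i) : ℂ)) / (Real.sqrt 2 : ℂ)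
    else ((g (j, i) : ℂ) - Complex.I * (g (i, j) : ℂ)) / (Real.sqrt 2 : ℂ)

theorem gueMatrix_isHermitian (n : ℕ) (g : Fin n × Fin n → ℝ) :
    (gueMatrix n g).IsHermitian := by
  ext i j
  rcases lt_trichotomy i j with h | h | h
  · simp [gueMatrix, Matrix.conjTranspose_apply, h, h.ne, h.ne', h.not_gt, sub_eq_add_neg]
  · subst h
    simp [gueMatrix, Matrix.conjTranspose_apply]
  · simp [gueMatrix, Matrix.conjTranspose_apply, h, h.ne, h.ne', h.not_gt, sub_eq_add_neg]

theorem measurable_gueMatrix (n : ℕ) : Measurable (gueMatrix n) := by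
  refine measurable_pi_lambda _ fun i => measurable_pi_lambda _ fun j => ?_
  simp only [gueMatrix, Matrix.of_apply]
  split_ifs <;> fun_prop

/-- The law of the Gaussian Unitary Ensemble of size `n`, with density proportional to
`exp (- Tr H ^ 2 / 2)` on Hermitian matrices: the diagonal entries are standard real Gaussians,
the entries above the diagonal are standard complex Gaussians, all of them independent. -/
noncomputable def gueLaw (n : ℕ) : Measure (Matrix (Fin n) (Fin n) ℂ) :=
  (Measure.pi fun _ : Fin n × Fin n => gaussianReal 0 1).map (gueMatrix n)

instance isProbabilityMeasure_gueLaw (n : ℕ) : IsProbabilityMeasure (gueLaw n) :=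
  Measure.isProbabilityMeasure_map (measurable_gueMatrix n).aemeasurable

/-- `√((1 + t) / 2) X + i √((1 - t) / 2) Y`. -/
noncomputable def ellipticCombination (n : ℕ) (t : ℝ)
    (p : Matrix (Fin n) (Fin n) ℂ × Matrix (Fin n) (Fin n) ℂ) : Matrix (Fin n) (Fin n) ℂ :=
  (Real.sqrt ((1 + t) / 2) : ℂ) • p.1 + (Complex.I * (Real.sqrt ((1 - t) / 2) : ℂ)) • p.2

theorem measurable_ellipticCombination (n : ℕ) (t : ℝ) :
    Measurable (ellipticCombination n t) := by
  refine measurable_pi_lambda _ fun i => measurable_pi_lambda _ fun j => ?_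
  have h1 : Measurable fun p : Matrix (Fin n) (Fin n) ℂ × Matrix (Fin n) (Fin n) ℂ => p.1 i j :=
    (measurable_pi_apply j).comp ((measurable_pi_apply i).comp measurable_fst)
  have h2 : Measurable fun p : Matrix (Fin n) (Fin n) ℂ × Matrix (Fin n) (Fin n) ℂ => p.2 i j :=
    (measurable_pi_apply j).comp ((measurable_pi_apply i).comp measurable_snd)
  simp only [ellipticCombination, Matrix.add_apply, Matrix.smul_apply, smul_eq_mul]
  exact (h1.const_mul _).add (h2.const_mul _)

/-- The law of the Elliptic Ginibre Ensemble of size `n` at `t`: the law of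
`√((1 + t) / 2) X + i √((1 - t) / 2) Y` with `X` and `Y` independent GUE matrices of size `n`. -/
noncomputable def ellipticGinibreLaw (n : ℕ) (t : ℝ) : Measure (Matrix (Fin n) (Fin n) ℂ) :=
  ((gueLaw n).prod (gueLaw n)).map (ellipticCombination n t)

instance isProbabilityMeasure_ellipticGinibreLaw (n : ℕ) (t : ℝ) :
    IsProbabilityMeasure (ellipticGinibreLaw n t) :=
  Measure.isProbabilityMeasure_map (measurable_ellipticCombination n t).aemeasurable

/-- `U_{k,t}^{(n)} = Tr P_k^{(t)} (M / √n) + n t δ_{k = 2}` as a function of the matrix `M`. -/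
noncomputable def traceStat (n : ℕ) (t : ℝ) (k : ℕ) (M : Matrix (Fin n) (Fin n) ℂ) : ℂ :=
  (Polynomial.aeval ((Real.sqrt n : ℂ)⁻¹ • M) (modChebyshev t k)).trace
    + if k = 2 then (n : ℂ) * (t : ℂ) else 0

/-- `V_{k,t}^{(n)} = U_{k,t}^{(n)} - E [U_{k,t}^{(n)}]` for a random matrix `A` of size `n`. -/
noncomputable def centredTrace {Ω : Type*} [MeasurableSpace Ω] (P : Measure Ω) (n : ℕ) (t : ℝ)
    (A : Ω → Matrix (Fin n) (Fin n) ℂ) (k : ℕ) (ω : Ω) : ℂ :=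
  traceStat n t k (A ω) - ∫ ω', traceStat n t k (A ω') ∂P

/-! The proof is Stein's method with loop equations, carried out on traces of polynomials in `A /
√n` and its adjoint. All entries are linear forms in independent real Gaussians. The covariance of
entries `(i, j)` and `(k, l)` of two letters is `c / n` if `i = l` and `j = k`, and zero otherwise,
where `c = t` for equal letters and `c = 1` for opposite ones (`sum_ellCoeff_mul_ellCoeff`).
Gaussian integration by parts against a phase `exp q` then gives `phaseExp_trace_ellMatrix_mul`.
Applied to words without a phase, it shortens them, so induction on length bounds the normalised
mean traces and all mixed moments of centred traces (`isBigO_wordMean_and_cenProd`).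

Write `P_k` and `U_k` for the Chebyshev polynomials of the first and second kind. The difference
quotient of `U_k` is the sum of `U_r ⊗ U_{k-1-r}`. This makes the `U_k` asymptotically orthogonal:
the normalised mean trace of `U_j(ε) U_k(δ)` tends to `c ^ k` if `j = k` and to `0` otherwise
(`tendsto_ellMean_ellUU`). In the loop equation for `P_{k+1} = X U_k - 2 t U_{k-1}`, with `k ≥ 1`,
the divergence of `U_k` fluctuates like `2 t Tr U_{k-1}` up to a term vanishing in mean
(`ellNull_ellRem`), so the two contributions cancel. Only the gradient of the phase survives. Since
`P_{l+1}' = (l + 1) U_l`, orthogonality makes it asymptotically deterministic and diagonal in the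
degree.

Hence the characteristic function `φ` of a real linear combination of centred traces nearly solves
`φ' = - s v φ`, and so tends to `exp (- v / 2)` at `s = 1` (`tendsto_phaseExp_ellLin`). The limit
factorises over degrees, which is the independence claim. Lévy's theorem on finite blocks and the
portmanteau theorem on cylinders finish the proof (`tendsto_infinitePi_of_tendsto_charFun`). -/

/-! ### One-dimensional Gaussian integration by parts, and resampling of a coordinate. -/

/-- The derivative of density times `f` is density times `f' - x f`. An integrable function with
integrable derivative has a derivative of total integral zero, so no decay of `f` has to be checked.
-/
theorem integral_mul_gaussianReal_eq_integral_deriv {f f' : ℝ → ℂ}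
    (hf : ∀ x, HasDerivAt f (f' x) x) (h0 : Integrable f (gaussianReal 0 1))
    (h1 : Integrable f' (gaussianReal 0 1))
    (h2 : Integrable (fun x : ℝ => (x : ℂ) * f x) (gaussianReal 0 1)) :
    ∫ x : ℝ, (x : ℂ) * f x ∂gaussianReal 0 1 = ∫ x, f' x ∂gaussianReal 0 1 := by
  have key : ∀ h : ℝ → ℂ, Integrable h (gaussianReal 0 1) →
      Integrable (fun x : ℝ => (gaussianPDFReal 0 1 x : ℂ) * h x) := by
    intro h hh
    rw [gaussianReal_of_var_ne_zero _ one_ne_zero] at hh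
    have := (integrable_withDensity_iff_integrable_smul' (measurable_gaussianPDF 0 1)
      (by simp [gaussianPDF_lt_top])).1 hh
    simpa [toReal_gaussianPDF] using this
  rw [integral_gaussianReal_eq_integral_smul one_ne_zero,
    integral_gaussianReal_eq_integral_smul one_ne_zero]
  have hd : ∀ x : ℝ, HasDerivAt (fun x : ℝ => (gaussianPDFReal 0 1 x : ℂ))
      (-(x : ℂ) * (gaussianPDFReal 0 1 x : ℂ)) x := by
    intro x
    have : HasDerivAt (gaussianPDFReal 0 1) (-x * gaussianPDFReal 0 1 x) x := by
      unfold gaussianPDFReal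
      have h : HasDerivAt (fun x : ℝ => -(x - 0) ^ 2 / (2 * ((1 : NNReal) : ℝ))) (-x) x := by
        have := (((hasDerivAt_id x).sub_const 0).pow 2).neg.div_const (2 * ((1 : NNReal) : ℝ))
        refine this.congr_deriv ?_
        simp
        ring
      refine (h.exp.const_mul _).congr_deriv ?_
      ring
    simpa using this.ofReal_comp
  have h3 := integral_eq_zero_of_hasDerivAt_of_integrable (fun x => (hd x).mul (hf x))
    (((key _ h1).add (key _ h2).neg).congr (ae_of_all _ fun x => by
      simp only [Pi.add_apply, Pi.neg_apply]; ring)) (key _ h0)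
  have h4 : ∫ x : ℝ,
      ((gaussianPDFReal 0 1 x : ℂ) * f' x - (gaussianPDFReal 0 1 x : ℂ) * ((x : ℂ) * f x))
      = 0 := by
    rw [← h3]; congr 1; ext x; ring
  rw [integral_sub (key _ h1) (key _ h2), sub_eq_zero] at h4
  simpa using h4.symm

/-- Resampling one coordinate does not change a product law. Fubini can thus isolate that coordinate
without splitting the index type. -/
theorem measurePreserving_update {ι : Type*} [Fintype ι] [DecidableEq ι] {α : Type*}
    [MeasurableSpace α] (μ : Measure α) [IsProbabilityMeasure μ] (i : ι) :
    MeasurePreserving (fun q : (ι → α) × α => Function.update q.1 i q.2)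
      ((Measure.pi fun _ => μ).prod μ) (Measure.pi fun _ => μ) := by
  have hm : Measurable (fun q : (ι → α) × α => Function.update q.1 i q.2) := by
    refine measurable_pi_lambda _ fun j => ?_
    by_cases h : j = i
    · subst h; simpa using measurable_snd
    · simp only [Function.update_of_ne h]
      exact (measurable_pi_apply j).comp measurable_fst
  refine ⟨hm, (Measure.pi_eq fun s hs => ?_).symm⟩
  rw [Measure.map_apply hm (MeasurableSet.univ_pi hs)]
  have : (fun q : (ι → α) × α => Function.update q.1 i q.2) ⁻¹' Set.univ.pi s
      = (Set.univ.pi (Function.update s i Set.univ)) ×ˢ s i := by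
    ext ⟨g, x⟩
    simp only [Set.mem_preimage, Set.mem_pi, Set.mem_univ, true_imp_iff, Set.mem_prod]
    constructor
    · intro h
      refine ⟨fun j => ?_, by simpa using h i⟩
      by_cases hj : j = i
      · subst hj; simp
      · simpa [Function.update_of_ne hj] using h j
    · rintro ⟨h, hx⟩ j
      by_cases hj : j = i
      · subst hj; simpa using hx
      · simpa [Function.update_of_ne hj] using h j
  rw [this, Measure.prod_prod, Measure.pi_pi, ← Finset.mul_prod_erase _ _ (Finset.mem_univ i),
    ← Finset.mul_prod_erase _ (fun j => μ (s j)) (Finset.mem_univ i), mul_comm (μ (s i))]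
  simp only [Function.update_self, measure_univ, one_mul]
  congr 1
  exact Finset.prod_congr rfl fun j hj => by
    rw [Function.update_of_ne (Finset.ne_of_mem_erase hj)]

/-! ### Complex polynomials at real points, and phases. -/

section RealEval

variable {ι : Type*}

/-- Evaluation of a complex polynomial at a real point. -/
noncomputable def realEval (g : ι → ℝ) : MvPolynomial ι ℂ →ₐ[ℂ] ℂ :=
  MvPolynomial.aeval fun i => (g i : ℂ)

@[simp] theorem realEval_X (g : ι → ℝ) (i : ι) : realEval g (MvPolynomial.X i) = g i := by
  simp [realEval]

@[simp] theorem realEval_C (g : ι → ℝ) (a : ℂ) : realEval g (MvPolynomial.C a) = a := by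
  simp [realEval]

theorem continuous_realEval (p : MvPolynomial ι ℂ) : Continuous fun g : ι → ℝ => realEval g p := by
  induction p using MvPolynomial.induction_on with
  | C a => simpa using continuous_const
  | add p q hp hq => simp only [map_add]; exact hp.add hq
  | mul_X p j hp =>
    simp only [map_mul, realEval_X]
    exact hp.mul (Complex.continuous_ofReal.comp (continuous_apply j))

theorem conj_realEval (g : ι → ℝ) (p : MvPolynomial ι ℂ) :
    (starRingEnd ℂ) (realEval g p) = realEval g (MvPolynomial.map (starRingEnd ℂ) p) := by
  induction p using MvPolynomial.induction_on with
  | C a => simp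
  | add p q hp hq => simp [hp, hq]
  | mul_X p j hp => simp [hp]

theorem hasDerivAt_realEval_update [DecidableEq ι] (p : MvPolynomial ι ℂ)
    (g : ι → ℝ) (i : ι) (x : ℝ) :
    HasDerivAt (fun x : ℝ => realEval (Function.update g i x) p)
      (realEval (Function.update g i x) (MvPolynomial.pderiv i p)) x := by
  induction p using MvPolynomial.induction_on with
  | C a => simpa using hasDerivAt_const x a
  | add p q hp hq => simp only [map_add]; exact hp.add hq
  | mul_X p j hp =>
    have hX : HasDerivAt (fun x : ℝ => ((Function.update g i x j : ℝ) : ℂ))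
        (if j = i then 1 else 0) x := by
      by_cases h : j = i
      · subst h
        simp only [Function.update_self, if_true]
        exact Complex.ofRealCLM.hasDerivAt
      · simpa [Function.update_of_ne h, h] using hasDerivAt_const x ((g j : ℝ) : ℂ)
    simp only [map_mul, realEval_X, Derivation.leibniz, smul_eq_mul, map_add,
      MvPolynomial.pderiv_X]
    refine (hp.mul hX).congr_deriv ?_
    by_cases h : j = i
    · subst h; simp; ring
    · simp [h]; ring

/-- `q` is purely imaginary at all real points. -/
def IsPhase (q : MvPolynomial ι ℂ) : Prop := ∀ g : ι → ℝ, (realEval g q).re = 0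

theorem IsPhase.norm_exp {q : MvPolynomial ι ℂ} (hq : IsPhase q) (g : ι → ℝ) :
    ‖Complex.exp (realEval g q)‖ = 1 := by
  rw [Complex.norm_exp, hq g, Real.exp_zero]

theorem isPhase_zero : IsPhase (0 : MvPolynomial ι ℂ) := fun g => by simp

end RealEval

/-! ### Gaussian expectations of polynomials against a phase. -/

section GaussianPolynomial

variable {ι : Type*} [Fintype ι]

/-- The standard Gaussian measure on `ι → ℝ`. -/
noncomputable abbrev stdGaussianPi (ι : Type*) [Fintype ι] : Measure (ι → ℝ) :=
  Measure.pi fun _ => gaussianReal 0 1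

theorem integrable_realEval (p : MvPolynomial ι ℂ) :
    Integrable (fun g => realEval g p) (stdGaussianPi ι) := by
  induction p using MvPolynomial.monomial_add_induction_on with
  | C a => simp
  | monomial_add a b f _ _ hf =>
    simp only [map_add]
    refine Integrable.add ?_ hf
    have : ∀ g : ι → ℝ, realEval g (MvPolynomial.monomial a b) = b * ∏ i, ((g i : ℂ)) ^ a i := by
      intro g
      simp [realEval, MvPolynomial.aeval_monomial, Finsupp.prod_fintype]
    simp only [this]
    refine Integrable.const_mul ?_ b
    refine Integrable.fintype_prod (f := fun i (x : ℝ) => (x : ℂ) ^ a i) fun i => ?_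
    have h : MemLp (id : ℝ → ℝ) ((a i : ENNReal)) (gaussianReal 0 1) :=
      memLp_id_gaussianReal' _ (by simp)
    have h2 := h.integrable_norm_pow'
    refine (integrable_norm_iff (by fun_prop)).1 ?_
    simpa using h2

theorem IsPhase.integrable {q : MvPolynomial ι ℂ} (hq : IsPhase q) (p : MvPolynomial ι ℂ) :
    Integrable (fun g => realEval g p * Complex.exp (realEval g q)) (stdGaussianPi ι) := by
  refine (integrable_realEval p).mul_bdd (c := 1) ?_ (ae_of_all _ fun g => (hq.norm_exp g).le)
  exact (Complex.continuous_exp.comp (continuous_realEval q)).aestronglyMeasurable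

/-- The expectation of `p` against the phase `exp q` under the standard Gaussian measure. -/
noncomputable def phaseExp {q : MvPolynomial ι ℂ} (hq : IsPhase q) : MvPolynomial ι ℂ →ₗ[ℂ] ℂ where
  toFun p := ∫ g, realEval g p * Complex.exp (realEval g q) ∂stdGaussianPi ι
  map_add' p p' := by
    simp only [map_add, add_mul]
    exact integral_add (hq.integrable p) (hq.integrable p')
  map_smul' c p := by
    simp only [map_smul, smul_eq_mul, mul_assoc, RingHom.id_apply]
    exact integral_const_mul _ _

theorem phaseExp_apply {q : MvPolynomial ι ℂ} (hq : IsPhase q) (p : MvPolynomial ι ℂ) :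
    phaseExp hq p = ∫ g, realEval g p * Complex.exp (realEval g q) ∂stdGaussianPi ι := rfl

theorem norm_phaseExp_le {q : MvPolynomial ι ℂ} (hq : IsPhase q) (p : MvPolynomial ι ℂ) :
    ‖phaseExp hq p‖ ≤ ∫ g, ‖realEval g p‖ ∂stdGaussianPi ι := by
  refine (norm_integral_le_integral_norm _).trans_eq ?_
  simp [hq.norm_exp]

/-- After resampling coordinate `i`, Fubini reduces the claim to one-dimensional integration by
parts. The second term comes from differentiating `exp q`. -/
theorem phaseExp_X_mul [DecidableEq ι] {q : MvPolynomial ι ℂ} (hq : IsPhase q) (i : ι)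
    (p : MvPolynomial ι ℂ) :
    phaseExp hq (MvPolynomial.X i * p) =
      phaseExp hq (MvPolynomial.pderiv i p + p * MvPolynomial.pderiv i q) := by
  have hmp := measurePreserving_update (gaussianReal 0 1) i
  have hint : ∀ p : MvPolynomial ι ℂ, Integrable (fun z : (ι → ℝ) × ℝ =>
      realEval (Function.update z.1 i z.2) p *
        Complex.exp (realEval (Function.update z.1 i z.2) q))
      ((stdGaussianPi ι).prod (gaussianReal 0 1)) := fun p =>
    (hmp.integrable_comp (hq.integrable p).aestronglyMeasurable).2 (hq.integrable p)
  have hfub : ∀ p : MvPolynomial ι ℂ, phaseExp hq p = ∫ g, ∫ x,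
      realEval (Function.update g i x) p * Complex.exp (realEval (Function.update g i x) q)
        ∂gaussianReal 0 1 ∂stdGaussianPi ι := by
    intro p
    rw [← integral_prod _ (hint p), phaseExp_apply]
    have := integral_map hmp.aemeasurable (f := fun g => realEval g p * Complex.exp (realEval g q))
      (by rw [hmp.map_eq]; exact (hq.integrable p).aestronglyMeasurable)
    rwa [hmp.map_eq] at this
  rw [hfub, hfub]
  refine integral_congr_ae ?_
  filter_upwards [(hint (MvPolynomial.X i * p)).prod_right_ae, (hint p).prod_right_ae,
    (hint (MvPolynomial.pderiv i p + p * MvPolynomial.pderiv i q)).prod_right_ae] with g h1 h2 h3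
  have hd : ∀ x : ℝ, HasDerivAt (fun x : ℝ => realEval (Function.update g i x) p *
      Complex.exp (realEval (Function.update g i x) q))
      (realEval (Function.update g i x) (MvPolynomial.pderiv i p + p * MvPolynomial.pderiv i q) *
        Complex.exp (realEval (Function.update g i x) q)) x := by
    intro x
    have e1 := hasDerivAt_realEval_update p g i x
    have e2 := hasDerivAt_realEval_update q g i x
    refine (e1.mul e2.cexp).congr_deriv ?_
    simp only [map_add, map_mul]
    ring
  have := integral_mul_gaussianReal_eq_integral_deriv hd h2 h3
    (h1.congr (ae_of_all _ fun x => by simp [mul_assoc]))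
  rw [← this]
  refine integral_congr_ae (ae_of_all _ fun x => by simp [mul_assoc])

end GaussianPolynomial

/-! ### Covariance of the GUE entries. -/

section GUECovariance

variable {n : ℕ}

/-- The coefficient of the Gaussian variable `p` in the entry `(i, j)` of the GUE matrix. -/
noncomputable def gueCoeff (i j : Fin n) (p : Fin n × Fin n) : ℂ :=
  gueMatrix n (Pi.single p 1) i j

theorem gueMatrix_apply_eq_sum (g : Fin n × Fin n → ℝ) (i j : Fin n) :
    gueMatrix n g i j = ∑ p, gueCoeff i j p * (g p : ℂ) := by
  rcases lt_trichotomy i j with h | h | h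
  · simp [gueCoeff, gueMatrix, h, h.ne, Pi.single_apply, add_mul, add_div, Finset.sum_add_distrib,
      ite_div, ite_mul, apply_ite Complex.ofReal]
    ring
  · subst h
    simp [gueCoeff, gueMatrix, Pi.single_apply, apply_ite Complex.ofReal]
  · simp [gueCoeff, gueMatrix, h.ne', h.not_gt, Pi.single_apply, sub_mul, sub_div,
      Finset.sum_sub_distrib, ite_div, ite_mul, apply_ite Complex.ofReal]
    ring

theorem conj_gueCoeff (i j : Fin n) (p : Fin n × Fin n) :
    (starRingEnd ℂ) (gueCoeff i j p) = gueCoeff j i p :=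
  (gueMatrix_isHermitian n (Pi.single p 1)).apply j i

theorem gueCoeff_apply (i j : Fin n) (p : Fin n × Fin n) :
    gueCoeff i j p = (if p = (i, j) then (if i = j then 1 else ((√2 : ℝ) : ℂ)⁻¹ *
        (if i < j then 1 else - Complex.I)) else 0)
      + (if p = (j, i) then (if i = j then 0 else ((√2 : ℝ) : ℂ)⁻¹ *
        (if i < j then Complex.I else 1)) else 0) := by
  rcases lt_trichotomy i j with h | h | h
  · simp [gueCoeff, gueMatrix, h, h.ne, Pi.single_apply, apply_ite Complex.ofReal, eq_comm]
    split_ifs <;> ring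
  · subst h
    simp [gueCoeff, gueMatrix, Pi.single_apply, apply_ite Complex.ofReal, eq_comm]
  · simp [gueCoeff, gueMatrix, h.ne', h.not_gt, Pi.single_apply, apply_ite Complex.ofReal, eq_comm]
    split_ifs <;> ring

/-- Off the diagonal, the two real variables contribute `1/2` and `-I ^ 2 / 2`, which add up for
transposed positions. For equal positions they contribute `1/2` and `I ^ 2 / 2`, which cancel. -/
theorem sum_gueCoeff_mul_gueCoeff (i j k l : Fin n) :
    ∑ p, gueCoeff i j p * gueCoeff k l p = if i = l ∧ j = k then 1 else 0 := by
  have h2 : ((√2 : ℝ) : ℂ)⁻¹ * ((√2 : ℝ) : ℂ)⁻¹ = 1 / 2 := by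
    rw [← mul_inv, ← Complex.ofReal_mul, Real.mul_self_sqrt (by norm_num)]
    norm_num
  generalize hs : ((√2 : ℝ) : ℂ)⁻¹ = s at h2
  have hs' : s ^ 2 = 1 / 2 := by rw [sq, h2]
  have hI := Complex.I_sq
  simp only [gueCoeff_apply, hs, add_mul, mul_add, Finset.sum_add_distrib, ite_mul, zero_mul,
    Finset.sum_ite_eq', Finset.mem_univ, if_true, Prod.mk.injEq]
  by_cases hij : i = j
  · subst hij
    by_cases hkl : k = l
    · subst hkl
      by_cases hik : i = k <;> simp [hik]
    · have : ¬ (i = l ∧ i = k) := fun h => hkl (h.2.symm.trans h.1)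
      have h' : ¬ (i = k ∧ i = l) := fun h => hkl (h.1.symm.trans h.2)
      simp [this, h']
  · by_cases hkl : k = l
    · subst hkl
      have : ¬ (i = k ∧ j = k) := fun h => hij (h.1.trans h.2.symm)
      have h' : ¬ (j = k ∧ i = k) := fun h => hij (h.2.trans h.1.symm)
      simp [this, h']
    · by_cases h1 : i = l ∧ j = k
      · obtain ⟨rfl, rfl⟩ := h1
        have h' : ¬ (i = j ∧ j = i) := fun h => hij h.1
        rcases lt_or_gt_of_ne hij with h | h
        · simp [hij, Ne.symm hij, h, h.not_gt]
          linear_combination (1 + -Complex.I ^ 2) * hs' - 1/2 * hI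
        · simp [hij, Ne.symm hij, h, h.not_gt]
          linear_combination (1 + -Complex.I ^ 2) * hs' - 1/2 * hI
      · have h1' : ¬ (j = k ∧ i = l) := fun h => h1 h.symm
        by_cases h3 : i = k ∧ j = l
        · obtain ⟨rfl, rfl⟩ := h3
          have h' : ¬ (i = j ∧ j = i) := fun h => hij h.1
          rcases lt_or_gt_of_ne hij with h | h
          · simp [hij, Ne.symm hij, h]
            linear_combination (1 + Complex.I ^ 2) * hs' + 1/2 * hI
          · simp [hij, Ne.symm hij, h.not_gt]
            linear_combination (1 + Complex.I ^ 2) * hs' + 1/2 * hI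
        · have h3' : ¬ (j = l ∧ i = k) := fun h => h3 h.symm
          simp [h1, h1', h3, h3']

end GUECovariance

/-! ### The two letters `A / √n` and its adjoint, and their dual derivations. -/

/-- The indices of the real Gaussian variables entering an elliptic Ginibre matrix. -/
abbrev EllIndex (n : ℕ) : Type := (Fin n × Fin n) ⊕ (Fin n × Fin n)

/-- Complex polynomials in the real Gaussian variables. -/
abbrev EllPoly (n : ℕ) : Type := MvPolynomial (EllIndex n) ℂ

/-- The coefficient of the Gaussian variable `p` in the entry `(i, j)` of `A / √n` (for
`ε = true`) or of its adjoint (for `ε = false`). -/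
noncomputable def ellCoeff (t : ℝ) {n : ℕ} (ε : Bool) (i j : Fin n) : EllIndex n → ℂ :=
  Sum.elim
    (fun p => ((√n : ℝ) : ℂ)⁻¹ * ((√((1 + t) / 2) : ℝ) : ℂ) * gueCoeff i j p)
    (fun p => ((√n : ℝ) : ℂ)⁻¹ * ((if ε then Complex.I else -Complex.I)
      * ((√((1 - t) / 2) : ℝ) : ℂ)) * gueCoeff i j p)

/-- The covariance of the pair of letters `ε`, `δ`. -/
def ellCov (t : ℝ) (ε δ : Bool) : ℂ := if ε = δ then (t : ℂ) else 1

@[simp] theorem ellCov_self (t : ℝ) (ε : Bool) : ellCov t ε ε = t := by simp [ellCov]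

/-- The weights combine to `(1 + t) / 2 - (1 - t) / 2 = t` for equal letters and to `(1 + t) / 2 +
(1 - t) / 2 = 1` for opposite ones, because the sign of `I` differs between the letters. -/
theorem sum_ellCoeff_mul_ellCoeff {t : ℝ} (ht : t ∈ Set.Icc (0 : ℝ) 1) {n : ℕ} (ε δ : Bool)
    (i j k l : Fin n) :
    ∑ p, ellCoeff t ε i j p * ellCoeff t δ k l p =
      (n : ℂ)⁻¹ * ellCov t ε δ * if i = l ∧ j = k then 1 else 0 := by
  rw [← sum_gueCoeff_mul_gueCoeff, Fintype.sum_sum_type]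
  simp only [ellCoeff, Sum.elim_inl, Sum.elim_inr]
  have h1 : ((√((1 + t) / 2) : ℝ) : ℂ) * ((√((1 + t) / 2) : ℝ) : ℂ) = (1 + t) / 2 := by
    rw [← Complex.ofReal_mul, Real.mul_self_sqrt (by linarith [ht.1])]; push_cast; ring
  have h2 : ((√((1 - t) / 2) : ℝ) : ℂ) * ((√((1 - t) / 2) : ℝ) : ℂ) = (1 - t) / 2 := by
    rw [← Complex.ofReal_mul, Real.mul_self_sqrt (by linarith [ht.2])]; push_cast; ring
  have h3 : ((√n : ℝ) : ℂ)⁻¹ * ((√n : ℝ) : ℂ)⁻¹ = (n : ℂ)⁻¹ := by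
    rw [← mul_inv, ← Complex.ofReal_mul, Real.mul_self_sqrt (Nat.cast_nonneg n)]; simp
  have hI := Complex.I_mul_I
  generalize ((√((1 + t) / 2) : ℝ) : ℂ) = α at *
  generalize ((√((1 - t) / 2) : ℝ) : ℂ) = β at *
  generalize ((√n : ℝ) : ℂ)⁻¹ = s at *
  rw [Finset.mul_sum, ← Finset.sum_add_distrib]
  refine Finset.sum_congr rfl fun p _ => ?_
  rw [← h3]
  have key : α * α + (if ε then Complex.I else -Complex.I) * (if δ then Complex.I else -Complex.I)
      * (β * β) = ellCov t ε δ := by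
    rw [h1, h2]
    cases ε <;> cases δ <;> simp [ellCov] <;> ring
  rw [← key]
  ring

theorem conj_ellCoeff (t : ℝ) {n : ℕ} (ε : Bool) (i j : Fin n) (p : EllIndex n) :
    (starRingEnd ℂ) (ellCoeff t ε i j p) = ellCoeff t (!ε) j i p := by
  rcases p with p | p
  · simp [ellCoeff, conj_gueCoeff]
  · cases ε <;> simp [ellCoeff, conj_gueCoeff]

/-- The matrix `A / √n` (for `ε = true`) or its adjoint (for `ε = false`), with entries linear
forms in the Gaussian variables. -/
noncomputable def ellMatrix (t : ℝ) (ε : Bool) (n : ℕ) : Matrix (Fin n) (Fin n) (EllPoly n) :=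
  Matrix.of fun i j => ∑ p, MvPolynomial.C (ellCoeff t ε i j p) * MvPolynomial.X p

/-- The derivation dual to the entry `(i, j)` of `ellMatrix t ε n`. -/
noncomputable def ellDeriv (t : ℝ) {n : ℕ} (ε : Bool) (i j : Fin n) :
    Derivation ℂ (EllPoly n) (EllPoly n) :=
  ∑ p, ellCoeff t ε i j p • MvPolynomial.pderiv p

theorem ellDeriv_apply (t : ℝ) {n : ℕ} (ε : Bool) (i j : Fin n) (p : EllPoly n) :
    ellDeriv t ε i j p = ∑ a, ellCoeff t ε i j a • MvPolynomial.pderiv a p := by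
  rw [ellDeriv, ← Derivation.coeFnAddMonoidHom_apply, map_sum, Finset.sum_apply]
  rfl

theorem phaseExp_ellMatrix_mul (t : ℝ) {n : ℕ} {q : EllPoly n} (hq : IsPhase q) (ε : Bool)
    (i j : Fin n) (p : EllPoly n) :
    phaseExp hq (ellMatrix t ε n i j * p) =
      phaseExp hq (ellDeriv t ε i j p + p * ellDeriv t ε i j q) := by
  simp only [ellDeriv_apply, ellMatrix, Matrix.of_apply, Finset.sum_mul, Finset.mul_sum, map_sum,
    ← Finset.sum_add_distrib, MvPolynomial.C_mul', smul_mul_assoc, mul_smul_comm, ← smul_add,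
    map_smul, phaseExp_X_mul]

theorem ellDeriv_ellMatrix {t : ℝ} (ht : t ∈ Set.Icc (0 : ℝ) 1) {n : ℕ} (ε δ : Bool)
    (i j k l : Fin n) :
    ellDeriv t ε i j (ellMatrix t δ n k l) =
      ((n : ℂ)⁻¹ * ellCov t ε δ) • if i = l ∧ j = k then 1 else 0 := by
  have := sum_ellCoeff_mul_ellCoeff ht ε δ i j k l
  have h : ∀ a : EllIndex n, MvPolynomial.pderiv a (ellMatrix t δ n k l)
      = MvPolynomial.C (ellCoeff t δ k l a) := by
    intro a
    simp only [ellMatrix, Matrix.of_apply, map_sum, MvPolynomial.pderiv_C_mul,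
      MvPolynomial.pderiv_X]
    rw [Finset.sum_eq_single a]
    · simp [MvPolynomial.C_eq_smul_one]
    · intro b _ hb
      simp [hb.symm]
    · simp
  simp only [ellDeriv_apply, h, MvPolynomial.smul_eq_C_mul, ← map_mul, ← map_sum, this]
  split_ifs <;> simp

theorem map_conj_ellMatrix (t : ℝ) {n : ℕ} (ε : Bool) (i j : Fin n) :
    MvPolynomial.map (starRingEnd ℂ) (ellMatrix t ε n i j) = ellMatrix t (!ε) n j i := by
  simp [ellMatrix, conj_ellCoeff]

/-! ### The loop equation and noncommutative difference quotients. -/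

section LoopEquation

open Finset

variable (t : ℝ) {n : ℕ}

/-- The contraction `∑ D_{ij} Z_{ji}`. -/
noncomputable def ellDiv (ε : Bool) (Z : Matrix (Fin n) (Fin n) (EllPoly n)) : EllPoly n :=
  ∑ i, ∑ j, ellDeriv t ε i j (Z j i)

/-- The derivation `∑ Z_{ji} D_{ij}`. -/
noncomputable def ellGrad (ε : Bool) (Z : Matrix (Fin n) (Fin n) (EllPoly n)) :
    Derivation ℂ (EllPoly n) (EllPoly n) :=
  ∑ i, ∑ j, Z j i • ellDeriv t ε i j

theorem ellGrad_apply (ε : Bool) (Z : Matrix (Fin n) (Fin n) (EllPoly n)) (p : EllPoly n) :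
    ellGrad t ε Z p = ∑ i, ∑ j, Z j i * ellDeriv t ε i j p := by
  simp only [ellGrad, ← Derivation.coeFnAddMonoidHom_apply, map_sum, Finset.sum_apply]
  rfl

/-- The **loop equation**: integration by parts for the trace of a product of matrices. -/
theorem phaseExp_trace_ellMatrix_mul {q : EllPoly n} (hq : IsPhase q) (ε : Bool)
    (Z : Matrix (Fin n) (Fin n) (EllPoly n)) (G : EllPoly n) :
    phaseExp hq ((ellMatrix t ε n * Z).trace * G) =
      phaseExp hq (ellDiv t ε Z * G + ellGrad t ε Z G + G * ellGrad t ε Z q) := by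
  simp only [Matrix.trace, Matrix.diag_apply, Matrix.mul_apply, sum_mul, ellDiv, ellGrad_apply,
    mul_sum, ← sum_add_distrib, map_sum, mul_assoc, phaseExp_ellMatrix_mul]
  refine sum_congr rfl fun i _ => sum_congr rfl fun j _ => ?_
  simp only [Derivation.leibniz, smul_eq_mul]
  congr 1
  ring

theorem ellDeriv_mul_apply (ε : Bool) (i j k l : Fin n)
    (A B : Matrix (Fin n) (Fin n) (EllPoly n)) :
    ellDeriv t ε i j ((A * B) k l) =
      ∑ s, (ellDeriv t ε i j (A k s) * B s l + A k s * ellDeriv t ε i j (B s l)) := by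
  simp only [Matrix.mul_apply, map_sum, Derivation.leibniz, smul_eq_mul]
  exact sum_congr rfl fun s _ => by ring

/-- The difference quotient of `A` with respect to the letter `ε` is `∑ c r • L r ⊗ R r`. -/
def IsSplit (ε : Bool) (A : Matrix (Fin n) (Fin n) (EllPoly n)) (m : ℕ) (c : ℕ → ℂ)
    (L R : ℕ → Matrix (Fin n) (Fin n) (EllPoly n)) : Prop :=
  ∀ i j k l, ellDeriv t ε i j (A k l) = (n : ℂ)⁻¹ • ∑ r ∈ range m, c r • (L r k j * R r i l)

variable {t} {ε : Bool} {A B : Matrix (Fin n) (Fin n) (EllPoly n)} {m m' : ℕ} {c c' : ℕ → ℂ}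
  {L R L' R' : ℕ → Matrix (Fin n) (Fin n) (EllPoly n)}

/-- Contracting a matrix with its own letter cuts the cycle at that letter into two traces. In
contrast, `IsSplit.ellGrad_trace` glues two traces into one. -/
theorem IsSplit.ellDiv (h : IsSplit t ε A m c L R) :
    ellDiv t ε A = (n : ℂ)⁻¹ • ∑ r ∈ range m, c r • ((L r).trace * (R r).trace) := by
  simp only [_root_.ellDiv, h _ _ _ _, ← smul_sum]
  congr 1
  simp only [Matrix.trace, Matrix.diag_apply, sum_mul_sum, smul_sum]
  simp_rw [sum_comm (s := univ) (t := range m)]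
  exact sum_congr rfl fun r _ => sum_comm

theorem IsSplit.ellDiv_mul (h : IsSplit t ε A m c L R) (h' : IsSplit t ε B m' c' L' R') :
    _root_.ellDiv t ε (A * B) = (n : ℂ)⁻¹ • ∑ r ∈ range m, c r • ((L r).trace * (R r * B).trace)
      + (n : ℂ)⁻¹ • ∑ r ∈ range m', c' r • ((A * L' r).trace * (R' r).trace) := by
  simp only [_root_.ellDiv, ellDeriv_mul_apply, h _ _ _ _, h' _ _ _ _, sum_add_distrib]
  simp only [smul_mul_assoc, mul_smul_comm, sum_mul, mul_sum, ← smul_sum]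
  congr 2
  · simp only [Matrix.trace, Matrix.diag_apply, Matrix.mul_apply, mul_assoc]
    simp_rw [sum_comm (s := univ) (t := range m)]
    refine sum_congr rfl fun r _ => ?_
    simp only [← smul_sum, ← mul_sum, ← sum_mul]
  · simp only [Matrix.trace, Matrix.diag_apply, Matrix.mul_apply, ← mul_assoc]
    simp_rw [sum_comm (s := univ) (t := range m')]
    refine sum_congr rfl fun r _ => ?_
    simp only [← smul_sum, ← mul_sum, ← sum_mul]

theorem IsSplit.ellGrad_trace (h : IsSplit t ε A m c L R)
    (Z : Matrix (Fin n) (Fin n) (EllPoly n)) :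
    ellGrad t ε Z A.trace = (n : ℂ)⁻¹ • ∑ r ∈ range m, c r • (Z * (R r * L r)).trace := by
  simp only [ellGrad_apply, Matrix.trace, Matrix.diag_apply, map_sum, h _ _ _ _, ← smul_sum,
    mul_smul_comm]
  congr 1
  simp only [Matrix.mul_apply, mul_sum, smul_sum, mul_smul_comm]
  simp_rw [sum_comm (s := univ) (t := range m)]
  refine sum_congr rfl fun r _ => ?_
  rw [sum_comm]
  refine (sum_congr rfl fun i _ => sum_comm).trans (sum_comm.trans ?_)
  refine sum_congr rfl fun i _ => sum_congr rfl fun j _ => sum_congr rfl fun k _ => ?_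
  rw [mul_comm (R r j k)]

theorem ellDeriv_ellMatrix_mul_apply (ht : t ∈ Set.Icc (0 : ℝ) 1) (ε δ : Bool) (i j k l : Fin n)
    (B : Matrix (Fin n) (Fin n) (EllPoly n)) :
    ellDeriv t ε i j ((ellMatrix t δ n * B) k l) =
      (n : ℂ)⁻¹ • (ellCov t ε δ • ((1 : Matrix (Fin n) (Fin n) (EllPoly n)) k j * B i l)) +
        ∑ s, ellMatrix t δ n k s * ellDeriv t ε i j (B s l) := by
  simp only [ellDeriv_mul_apply, sum_add_distrib, ellDeriv_ellMatrix ht]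
  congr 1
  rw [sum_eq_single i]
  · by_cases h : j = k
    · subst h; simp [mul_smul]
    · simp [h, Ne.symm h]
  · intro s _ hs; simp [Ne.symm hs]
  · simp

/-- The matrix product of the letters of a word. -/
noncomputable def ellWord (t : ℝ) (w : List Bool) (n : ℕ) :
    Matrix (Fin n) (Fin n) (EllPoly n) :=
  (w.map fun δ => ellMatrix t δ n).prod

/-- Leibniz rule over the positions of the word: the letter at position `r` is removed. The default
value of `getD` is never reached, as `r` is below the length. -/
theorem isSplit_ellWord (ht : t ∈ Set.Icc (0 : ℝ) 1) (ε : Bool) (w : List Bool) :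
    IsSplit t ε (ellWord t w n) w.length (fun r => ellCov t ε (w.getD r true))
      (fun r => ellWord t (w.take r) n) (fun r => ellWord t (w.drop (r + 1)) n) := by
  induction w with
  | nil =>
    intro i j k l
    simp only [ellWord, List.map_nil, List.prod_nil, Matrix.one_apply]
    split_ifs <;> simp
  | cons δ w ih =>
    intro i j k l
    have e : ellWord t (δ :: w) n = ellMatrix t δ n * ellWord t w n := by simp [ellWord]
    rw [e, ellDeriv_ellMatrix_mul_apply ht]
    simp only [ih _ _ _ _, List.length_cons]
    rw [sum_range_succ', smul_add, add_comm]
    congr 1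
    · simp only [mul_smul_comm, ← smul_sum, mul_sum]
      rw [sum_comm]
      congr 1
      refine sum_congr rfl fun r _ => ?_
      have e : ellWord t ((δ :: w).take (r + 1)) n = ellMatrix t δ n * ellWord t (w.take r) n := by
        simp [ellWord]
      simp only [List.getD_cons_succ, List.drop_succ_cons, e, Matrix.mul_apply, sum_mul, smul_sum,
        mul_assoc]

/-- The Chebyshev polynomial of the second kind of degree `j` in the letter `δ`. -/
noncomputable def ellU (t : ℝ) (δ : Bool) (j n : ℕ) : Matrix (Fin n) (Fin n) (EllPoly n) :=
  Polynomial.aeval (ellMatrix t δ n) (Polynomial.dickson 2 (t : ℂ) j)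

@[simp] theorem ellU_zero (t : ℝ) (δ : Bool) (n : ℕ) : ellU t δ 0 n = 1 := by
  rw [ellU, Polynomial.dickson_zero]
  norm_num

theorem ellU_one (t : ℝ) (δ : Bool) (n : ℕ) : ellU t δ 1 n = ellMatrix t δ n := by
  simp [ellU]

theorem ellU_add_two (t : ℝ) (δ : Bool) (j n : ℕ) :
    ellU t δ (j + 2) n = ellMatrix t δ n * ellU t δ (j + 1) n - (t : ℂ) • ellU t δ j n := by
  simp [ellU, Polynomial.dickson_add_two, ← Algebra.smul_def]

/-- This is the identity that singles out the second kind: `(U_j(x) - U_j(y)) / (x - y)` is the sum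
of `U_r(x) U_{j-1-r}(y)` over `r < j`. It follows by applying the recurrence to the left factors. -/
theorem isSplit_ellU (ht : t ∈ Set.Icc (0 : ℝ) 1) (ε δ : Bool) (j : ℕ) :
    IsSplit t ε (ellU t δ j n) j (fun _ => ellCov t ε δ)
      (fun r => ellU t δ r n) (fun r => ellU t δ (j - 1 - r) n) := by
  induction j using Nat.twoStepInduction with
  | zero =>
    intro i j k l
    simp only [ellU_zero, Matrix.one_apply]
    split_ifs <;> simp
  | one =>
    intro i j k l
    have := ellDeriv_ellMatrix_mul_apply ht ε δ i j k l 1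
    rw [mul_one] at this
    rw [ellU_one, this]
    have h1 : ∀ s, ellDeriv t ε i j ((1 : Matrix (Fin n) (Fin n) (EllPoly n)) s l) = 0 := by
      intro s
      rw [Matrix.one_apply]
      split_ifs <;> simp
    simp [h1]
  | more d h0 h1 =>
    intro i j k l
    rw [ellU_add_two, Matrix.sub_apply, map_sub, ellDeriv_ellMatrix_mul_apply ht,
      Matrix.smul_apply, Derivation.map_smul, h0, sum_congr rfl fun s _ => by rw [h1],
      sum_range_succ', ← ellU_zero t δ n, smul_add, add_comm, add_sub_right_comm]
    congr 1
    simp only [mul_smul_comm, ← smul_sum, smul_comm (t : ℂ), mul_sum, ← smul_sub]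
    congr 1
    rw [sum_comm]
    congr 1
    -- The term with left factor `U_1` is set apart, since the two-step recurrence only applies to
    -- left factors of degree at least two.
    rw [sum_range_succ', sum_range_succ', add_sub_right_comm, smul_sum, ← sum_sub_distrib]
    congr 1
    · refine sum_congr rfl fun r _ => ?_
      have e : d + 2 - 1 - (r + 1 + 1) = d - 1 - r := by omega
      have e' : d + 1 - 1 - (r + 1) = d - 1 - r := by omega
      rw [e, e', ellU_add_two, Matrix.sub_apply, sub_mul, Matrix.mul_apply, sum_mul,
        Matrix.smul_apply, smul_mul_assoc]
      simp only [mul_assoc]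
    · have e : d + 2 - 1 - (0 + 1) = d := by omega
      rw [e, zero_add, ellU_one]
      simp [Matrix.one_apply]

/-- The gradient of the trace of a polynomial in one letter. -/
theorem ellGrad_trace_aeval (ht : t ∈ Set.Icc (0 : ℝ) 1) (ε δ : Bool) (p : Polynomial ℂ)
    (Z : Matrix (Fin n) (Fin n) (EllPoly n)) :
    ellGrad t ε Z (Polynomial.aeval (ellMatrix t δ n) p).trace =
      ((n : ℂ)⁻¹ * ellCov t ε δ) •
        (Z * Polynomial.aeval (ellMatrix t δ n) (Polynomial.derivative p)).trace := by
  induction p using Polynomial.induction_on' with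
  | add p q hp hq => simp only [map_add, Matrix.trace_add, hp, hq, mul_add, smul_add]
  | monomial k a =>
    have hw : ∀ m, ellWord t (List.replicate m δ) n = ellMatrix t δ n ^ m := by
      intro m; simp [ellWord]
    have h := (isSplit_ellWord ht ε (List.replicate k δ) (n := n)).ellGrad_trace Z
    have hs : ∀ r ∈ range (List.replicate k δ).length,
        ellCov t ε ((List.replicate k δ).getD r true) •
          (Z * (ellWord t ((List.replicate k δ).drop (r + 1)) n *
            ellWord t ((List.replicate k δ).take r) n)).trace =
          ellCov t ε δ • (Z * ellMatrix t δ n ^ (k - 1)).trace := by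
      intro r hr
      rw [List.length_replicate, mem_range] at hr
      rw [List.drop_replicate, List.take_replicate, hw, hw, ← pow_add]
      have e1 : k - (r + 1) + min r k = k - 1 := by omega
      have e2 : (List.replicate k δ).getD r true = δ := by
        simp [List.getD_eq_getElem?_getD, hr]
      rw [e1, e2]
    rw [sum_congr rfl hs, hw] at h
    simp only [Polynomial.aeval_monomial, Polynomial.derivative_monomial, ← Algebra.smul_def,
      Matrix.trace_smul, Derivation.map_smul, h, mul_smul_comm, sum_const, card_range,
      List.length_replicate, mul_smul, ← Nat.cast_smul_eq_nsmul ℂ]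
    simp only [smul_smul]
    congr 1
    ring

end LoopEquation

/-! ### Relations between the two kinds of Chebyshev polynomials. -/

/-- The Chebyshev polynomials of the first kind in terms of those of the second kind. -/
theorem dickson_one_add_two_eq (t : ℂ) (k : ℕ) :
    Polynomial.dickson 1 t (k + 2) = Polynomial.X * Polynomial.dickson 2 t (k + 1)
      - Polynomial.C (2 * t) * Polynomial.dickson 2 t k := by
  induction k using Nat.twoStepInduction with
  | zero =>
    simp only [Polynomial.dickson_add_two, Polynomial.dickson_zero, Polynomial.dickson_one,
      zero_add, map_mul, map_ofNat]
    norm_num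
    ring
  | one =>
    simp only [Polynomial.dickson_add_two, Polynomial.dickson_zero, Polynomial.dickson_one,
      zero_add, map_mul, map_ofNat]
    norm_num
    ring
  | more k h0 h1 =>
    rw [Polynomial.dickson_add_two _ _ (k + 2), h0, h1, Polynomial.dickson_add_two 2 _ (k + 1),
      Polynomial.dickson_add_two 2 _ k]
    simp only [map_mul, map_ofNat]
    ring

/-- It turns the gradient of a first-kind trace into a second-kind polynomial, to which
orthogonality applies. -/
theorem derivative_dickson_one (t : ℂ) (k : ℕ) :
    Polynomial.derivative (Polynomial.dickson 1 t (k + 1)) =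
      (k + 1 : ℕ) * Polynomial.dickson 2 t k := by
  induction k using Nat.twoStepInduction with
  | zero => simp; norm_num
  | one =>
    simp [Polynomial.dickson_add_two]
    ring
  | more k h0 h1 =>
    rw [Polynomial.dickson_add_two, Polynomial.derivative_sub, Polynomial.derivative_mul,
      Polynomial.derivative_C_mul, h0, h1, Polynomial.derivative_X, dickson_one_add_two_eq,
      Polynomial.dickson_add_two 2 _ k]
    simp only [map_mul, map_ofNat]
    push_cast
    ring

/-! ### A priori bounds on mean traces and on moments of centred traces. -/

section Moments

open Finset Asymptotics

/-- The expectation of a polynomial in the Gaussian variables. -/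
noncomputable def ellE {n : ℕ} : EllPoly n →ₗ[ℂ] ℂ := phaseExp isPhase_zero

theorem ellE_apply {n : ℕ} (p : EllPoly n) :
    ellE p = ∫ g, realEval g p ∂stdGaussianPi (EllIndex n) := by
  simp [ellE, phaseExp_apply]

@[simp] theorem ellE_one {n : ℕ} : ellE (1 : EllPoly n) = 1 := by
  simp [ellE_apply]

@[simp] theorem ellE_C_mul {n : ℕ} (a : ℂ) (p : EllPoly n) :
    ellE (MvPolynomial.C a * p) = a * ellE p := by
  rw [MvPolynomial.C_mul', map_smul, smul_eq_mul]

@[simp] theorem ellE_C {n : ℕ} (a : ℂ) : ellE (MvPolynomial.C a : EllPoly n) = a := by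
  simpa using ellE_C_mul a (1 : EllPoly n)

/-- The centred version of a polynomial. -/
noncomputable def ellCen {n : ℕ} : EllPoly n →ₗ[ℂ] EllPoly n :=
  LinearMap.id - (Algebra.linearMap ℂ (EllPoly n)).comp ellE

theorem ellCen_apply {n : ℕ} (p : EllPoly n) : ellCen p = p - MvPolynomial.C (ellE p) := rfl

@[simp] theorem ellCen_C {n : ℕ} (a : ℂ) : ellCen (MvPolynomial.C a : EllPoly n) = 0 := by
  simp [ellCen_apply]

@[simp] theorem ellGrad_ellCen (t : ℝ) {n : ℕ} (ε : Bool) (Z : Matrix (Fin n) (Fin n) (EllPoly n))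
    (p : EllPoly n) : ellGrad t ε Z (ellCen p) = ellGrad t ε Z p := by
  rw [ellCen_apply, map_sub, MvPolynomial.derivation_C, sub_zero]

theorem ellE_trace_ellMatrix_mul (t : ℝ) {n : ℕ} (ε : Bool)
    (Z : Matrix (Fin n) (Fin n) (EllPoly n)) (G : EllPoly n) :
    ellE ((ellMatrix t ε n * Z).trace * G) = ellE (ellDiv t ε Z * G + ellGrad t ε Z G) := by
  rw [ellE, phaseExp_trace_ellMatrix_mul]
  simp

theorem ellE_mul {n : ℕ} (p q : EllPoly n) :
    ellE (p * q) = ellE p * ellE q + ellE (ellCen p * ellCen q) := by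
  have h : ellCen p * ellCen q = p * q - MvPolynomial.C (ellE p) * q -
      MvPolynomial.C (ellE q) * p + MvPolynomial.C (ellE p * ellE q) := by
    simp only [ellCen_apply, map_mul]; ring
  rw [h]
  simp only [map_add, map_sub, ellE_C_mul, ellE_C]
  ring

/-- Separates the means, which are of order `n` for traces, from the centred parts. The factor `1 /
n` of the loop equation then compensates exactly one mean. -/
theorem ellE_mul_mul_sub {n : ℕ} (p q G : EllPoly n) :
    ellE (p * q * G) - ellE (p * q) * ellE G =
      ellE (ellCen p * ellCen q * G) - ellE (ellCen p * ellCen q) * ellE G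
        + ellE p * ellE (ellCen q * G) + ellE q * ellE (ellCen p * G) := by
  have h : p * q * G = ellCen p * ellCen q * G + MvPolynomial.C (ellE p) * (ellCen q * G)
      + MvPolynomial.C (ellE q) * (ellCen p * G) + MvPolynomial.C (ellE p * ellE q) * G := by
    simp only [ellCen_apply, map_mul]; ring
  have h2 := ellE_mul p q
  rw [h]
  simp only [map_add, ellE_C_mul]
  linear_combination (-ellE G) * h2

theorem ellE_ellCen_mul {n : ℕ} (p G : EllPoly n) :
    ellE (ellCen p * G) = ellE (p * G) - ellE p * ellE G := by
  rw [ellCen_apply, sub_mul, map_sub, ellE_C_mul]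

/-- The trace of a word. -/
noncomputable def wordTrace (t : ℝ) (w : List Bool) (n : ℕ) : EllPoly n := (ellWord t w n).trace

/-- The normalised expected trace of a word. -/
noncomputable def wordMean (t : ℝ) (w : List Bool) (n : ℕ) : ℂ := (n : ℂ)⁻¹ * ellE (wordTrace t w n)

theorem wordTrace_cons (t : ℝ) (ε : Bool) (w : List Bool) (n : ℕ) :
    wordTrace t (ε :: w) n = (ellMatrix t ε n * ellWord t w n).trace := by
  simp [wordTrace, ellWord]

theorem wordTrace_nil (t : ℝ) (n : ℕ) : wordTrace t [] n = MvPolynomial.C (n : ℂ) := by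
  simp [wordTrace, ellWord]

theorem ellDiv_ellWord {t : ℝ} (ht : t ∈ Set.Icc (0 : ℝ) 1) (ε : Bool) (w : List Bool) (n : ℕ) :
    ellDiv t ε (ellWord t w n) = (n : ℂ)⁻¹ • ∑ r ∈ range w.length,
      ellCov t ε (w.getD r true) • (wordTrace t (w.take r) n * wordTrace t (w.drop (r + 1)) n) :=
  (isSplit_ellWord ht ε w).ellDiv

theorem ellGrad_wordTrace {t : ℝ} (ht : t ∈ Set.Icc (0 : ℝ) 1) (ε : Bool) (v w : List Bool)
    (n : ℕ) :
    ellGrad t ε (ellWord t v n) (wordTrace t w n) = (n : ℂ)⁻¹ • ∑ r ∈ range w.length,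
      ellCov t ε (w.getD r true) • wordTrace t (v ++ (w.drop (r + 1) ++ w.take r)) n := by
  rw [wordTrace, (isSplit_ellWord ht ε w).ellGrad_trace]
  simp [wordTrace, ellWord]

theorem wordMean_cons {t : ℝ} (ht : t ∈ Set.Icc (0 : ℝ) 1) (ε : Bool) (w : List Bool) (n : ℕ) :
    wordMean t (ε :: w) n = ∑ r ∈ range w.length, ellCov t ε (w.getD r true) *
      (wordMean t (w.take r) n * wordMean t (w.drop (r + 1)) n + (n : ℂ)⁻¹ * (n : ℂ)⁻¹ *
        ellE (ellCen (wordTrace t (w.take r) n) * ellCen (wordTrace t (w.drop (r + 1)) n))) := by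
  have h := ellE_trace_ellMatrix_mul t ε (ellWord t w n) 1
  rw [mul_one, mul_one, Derivation.map_one_eq_zero, add_zero, ← wordTrace_cons,
    ellDiv_ellWord ht] at h
  rw [wordMean, h]
  simp only [map_smul, map_sum, smul_eq_mul, mul_sum, wordMean]
  refine sum_congr rfl fun r _ => ?_
  rw [ellE_mul]
  ring

/-- The difference of the loop equations with test functions `G` and `1`. The products of two means
cancel, and every word on the right is shorter or has been glued to `G`. -/
theorem ellE_ellCen_wordTrace_cons_mul {t : ℝ} (ht : t ∈ Set.Icc (0 : ℝ) 1) (ε : Bool)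
    (w : List Bool) {n : ℕ} (G : EllPoly n) :
    ellE (ellCen (wordTrace t (ε :: w) n) * G) = ∑ r ∈ range w.length,
      ellCov t ε (w.getD r true) *
        ((n : ℂ)⁻¹ * (ellE (ellCen (wordTrace t (w.take r) n) *
            ellCen (wordTrace t (w.drop (r + 1)) n) * G) -
          ellE (ellCen (wordTrace t (w.take r) n) * ellCen (wordTrace t (w.drop (r + 1)) n))
            * ellE G)
          + wordMean t (w.take r) n * ellE (ellCen (wordTrace t (w.drop (r + 1)) n) * G)
          + wordMean t (w.drop (r + 1)) n * ellE (ellCen (wordTrace t (w.take r) n) * G))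
      + ellE (ellGrad t ε (ellWord t w n) G) := by
  have h1 := ellE_trace_ellMatrix_mul t ε (ellWord t w n) 1
  rw [mul_one, mul_one, Derivation.map_one_eq_zero, add_zero, ← wordTrace_cons] at h1
  rw [ellE_ellCen_mul, h1, wordTrace_cons, ellE_trace_ellMatrix_mul, map_add, add_sub_right_comm,
    ellDiv_ellWord ht]
  congr 1
  simp only [smul_mul_assoc, sum_mul, map_smul, map_sum, smul_eq_mul, mul_sum,
    ← sum_sub_distrib, wordMean]
  refine sum_congr rfl fun r _ => ?_
  have := ellE_mul_mul_sub (wordTrace t (w.take r) n) (wordTrace t (w.drop (r + 1)) n) G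
  linear_combination (n : ℂ)⁻¹ * ellCov t ε (w.getD r true) * this

theorem isBigO_inv_one : (fun n : ℕ => (n : ℂ)⁻¹) =O[atTop] fun _ => (1 : ℝ) :=
  (tendsto_inv_atTop_nhds_zero_nat (𝕜 := ℂ)).isBigO_one ℝ

theorem Asymptotics.IsBigO.mul_one' {f g : ℕ → ℂ} (hf : f =O[atTop] fun _ => (1 : ℝ))
    (hg : g =O[atTop] fun _ => (1 : ℝ)) : (fun n => f n * g n) =O[atTop] fun _ => (1 : ℝ) := by
  simpa using hf.mul hg

theorem isBigO_one_sum {s : Finset ℕ} {f : ℕ → ℕ → ℂ}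
    (h : ∀ r ∈ s, f r =O[atTop] fun _ => (1 : ℝ)) :
    (fun n => ∑ r ∈ s, f r n) =O[atTop] fun _ => (1 : ℝ) := by
  simpa [← Finset.sum_apply] using IsBigO.sum h

theorem isBigO_zero_one : (fun _ : ℕ => (0 : ℂ)) =O[atTop] fun _ => (1 : ℝ) := isBigO_zero _ _

/-- The product of the centred traces of a list of words. -/
noncomputable def cenProd (t : ℝ) (ws : List (List Bool)) (n : ℕ) : EllPoly n :=
  (ws.map fun w => ellCen (wordTrace t w n)).prod

@[simp] theorem cenProd_cons (t : ℝ) (w : List Bool) (ws : List (List Bool)) (n : ℕ) :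
    cenProd t (w :: ws) n = ellCen (wordTrace t w n) * cenProd t ws n := by
  simp [cenProd]

@[simp] theorem cenProd_nil (t : ℝ) (n : ℕ) : cenProd t [] n = 1 := rfl

theorem cenProd_append (t : ℝ) (ws ws' : List (List Bool)) (n : ℕ) :
    cenProd t (ws ++ ws') n = cenProd t ws n * cenProd t ws' n := by
  simp [cenProd]

/-- Leibniz rule over the factors, with `pre` collecting those already passed. Differentiating one
factor gives `1 / n` times the trace of a glued word, that is, its normalised mean plus `1 / n`
times its centred trace. Both are controlled by hypothesis. -/
theorem isBigO_ellE_ellGrad_cenProd {t : ℝ} (ht : t ∈ Set.Icc (0 : ℝ) 1) (N : ℕ) (ε : Bool)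
    (v : List Bool)
    (hM : ∀ w : List Bool, w.length < N → wordMean t w =O[atTop] fun _ => (1 : ℝ))
    (hP : ∀ ws : List (List Bool), (ws.map List.length).sum < N →
      (fun n => ellE (cenProd t ws n)) =O[atTop] fun _ => (1 : ℝ)) (post pre : List (List Bool))
    (hN : v.length + (pre.map List.length).sum + (post.map List.length).sum < N) :
    (fun n => ellE (ellGrad t ε (ellWord t v n) (cenProd t post n) * cenProd t pre n))
      =O[atTop] fun _ => (1 : ℝ) := by
  induction post generalizing pre with
  | nil => simpa using isBigO_zero_one
  | cons w post ih =>
    simp only [List.map_cons, List.sum_cons] at hN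
    have h1 := ih (w :: pre) (by simp only [List.map_cons, List.sum_cons]; omega)
    have h2 : (fun n => ellE (cenProd t post n * ellGrad t ε (ellWord t v n) (wordTrace t w n) *
        cenProd t pre n)) =O[atTop] fun _ => (1 : ℝ) := by
      have e : ∀ n, ellE (cenProd t post n * ellGrad t ε (ellWord t v n) (wordTrace t w n) *
          cenProd t pre n) = ∑ r ∈ range w.length, ellCov t ε (w.getD r true) *
            ((n : ℂ)⁻¹ * ellE (cenProd t ((v ++ (w.drop (r + 1) ++ w.take r)) :: (post ++ pre)) n)
              + wordMean t (v ++ (w.drop (r + 1) ++ w.take r)) n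
                * ellE (cenProd t (post ++ pre) n)) := by
        intro n
        rw [mul_assoc, mul_comm _ (cenProd t pre n), ← mul_assoc, ← cenProd_append, mul_comm,
          ellGrad_wordTrace ht]
        simp only [smul_mul_assoc, sum_mul, map_smul, map_sum, smul_eq_mul, mul_sum]
        refine sum_congr rfl fun r _ => ?_
        rw [cenProd_cons, ellE_ellCen_mul, wordMean]
        ring
      simp only [e]
      refine isBigO_one_sum fun r hr => ?_
      rw [mem_range] at hr
      have hl : (v ++ (w.drop (r + 1) ++ w.take r)).length + 1 = v.length + w.length := by
        simp only [List.length_append, List.length_drop, List.length_take]; omega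
      refine (isBigO_const_const _ one_ne_zero _).mul_one' (IsBigO.add ?_ ?_)
      · refine isBigO_inv_one.mul_one' (hP _ ?_)
        simp only [List.map_cons, List.sum_cons, List.map_append, List.sum_append]
        omega
      · refine (hM _ (by omega)).mul_one' (hP _ ?_)
        simp only [List.map_append, List.sum_append]
        omega
    refine (h1.add h2).congr_left fun n => ?_
    rw [← map_add, cenProd_cons, cenProd_cons, Derivation.leibniz, ellGrad_ellCen, smul_eq_mul,
      smul_eq_mul]
    congr 1
    ring

/-- The loop equation consumes two letters, the leading one and its partner, so strong induction on
the total length closes. The two bounds are proved together because each equation involves both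
quantities. -/
theorem isBigO_wordMean_and_cenProd {t : ℝ} (ht : t ∈ Set.Icc (0 : ℝ) 1) (N : ℕ) :
    (∀ w : List Bool, w.length ≤ N → wordMean t w =O[atTop] fun _ => (1 : ℝ)) ∧
    (∀ ws : List (List Bool), (ws.map List.length).sum ≤ N →
      (fun n => ellE (cenProd t ws n)) =O[atTop] fun _ => (1 : ℝ)) := by
  induction N using Nat.strong_induction_on with
  | _ N ih =>
  have hM : ∀ w : List Bool, w.length < N → wordMean t w =O[atTop] fun _ => (1 : ℝ) :=
    fun w hw => (ih _ hw).1 w le_rfl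
  have hP : ∀ ws : List (List Bool), (ws.map List.length).sum < N →
      (fun n => ellE (cenProd t ws n)) =O[atTop] fun _ => (1 : ℝ) :=
    fun ws hw => (ih _ hw).2 ws le_rfl
  have hP2 : ∀ u v : List Bool, u.length + v.length < N → (fun n => ellE (
      ellCen (wordTrace t u n) * ellCen (wordTrace t v n))) =O[atTop] fun _ => (1 : ℝ) :=
    fun u v h => by simpa using hP [u, v] (by simpa using h)
  have hc : ∀ a : ℂ, (fun _ : ℕ => a) =O[atTop] fun _ => (1 : ℝ) :=
    fun a => isBigO_const_const _ one_ne_zero _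
  constructor
  · intro w hw
    cases w with
    | nil =>
      refine IsBigO.of_bound 1 (Eventually.of_forall fun n => ?_)
      rcases eq_or_ne n 0 with rfl | hn
      · simp [wordMean]
      · rw [wordMean, wordTrace_nil, ellE_C, inv_mul_cancel₀ (Nat.cast_ne_zero.2 hn)]
        simp
    | cons ε v =>
      rw [List.length_cons] at hw
      rw [funext (wordMean_cons ht ε v)]
      refine isBigO_one_sum fun r hr => ?_
      rw [mem_range] at hr
      have h1 : (v.take r).length = r := by simp; omega
      have h2 : (v.drop (r + 1)).length = v.length - (r + 1) := by simp
      exact (hc _).mul_one' (((hM _ (by omega)).mul_one' (hM _ (by omega))).add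
        ((isBigO_inv_one.mul_one' isBigO_inv_one).mul_one' (hP2 _ _ (by omega))))
  · intro ws hws
    match ws, hws with
    | [], _ => simpa using hc 1
    -- The trace of the empty word is deterministic, so its centred version vanishes.
    | [] :: ws, _ => simpa only [cenProd_cons, wordTrace_nil, ellCen_C, zero_mul, map_zero] using isBigO_zero_one
    | (ε :: v) :: ws, hws =>
      simp only [List.map_cons, List.sum_cons, List.length_cons] at hws
      simp only [cenProd_cons, ellE_ellCen_wordTrace_cons_mul ht]
      refine IsBigO.add (isBigO_one_sum fun r hr => ?_) ?_
      · rw [mem_range] at hr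
        have h1 : (v.take r).length = r := by simp; omega
        have h2 : (v.drop (r + 1)).length = v.length - (r + 1) := by simp
        have a1 := hP (v.take r :: v.drop (r + 1) :: ws)
          (by simp only [List.map_cons, List.sum_cons]; omega)
        have a2 := hP (v.take r :: ws) (by simp only [List.map_cons, List.sum_cons]; omega)
        have a3 := hP (v.drop (r + 1) :: ws) (by simp only [List.map_cons, List.sum_cons]; omega)
        simp only [cenProd_cons, ← mul_assoc] at a1 a2 a3
        refine (hc _).mul_one' (((isBigO_inv_one.mul_one' (a1.sub ((hP2 _ _ (by omega)).mul_one'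
          (hP _ (by omega))))).add ((hM _ (by omega)).mul_one' a3)).add
          ((hM _ (by omega)).mul_one' a2))
      · have := isBigO_ellE_ellGrad_cenProd ht N ε v hM hP ws [] (by simp; omega)
        simpa using this

end Moments

/-! ### The algebra of the two letters, and convergence in mean. -/

section WordAlgebra

open Finset Asymptotics Topology

/-- Sequences, indexed by the size, of matrices with polynomial entries. -/
abbrev EllMatSeq : Type := (n : ℕ) → Matrix (Fin n) (Fin n) (EllPoly n)

/-- The algebra generated by `A / √n` and its adjoint, with coefficients independent of `n`. -/
noncomputable def ellAlg (t : ℝ) : Subalgebra ℂ EllMatSeq :=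
  Algebra.adjoin ℂ (Set.range fun ε => (ellMatrix t ε : EllMatSeq))

theorem ellMatrix_mem_ellAlg (t : ℝ) (ε : Bool) : (ellMatrix t ε : EllMatSeq) ∈ ellAlg t :=
  Algebra.subset_adjoin ⟨ε, rfl⟩

theorem ellAlg_induction {t : ℝ} {p : EllMatSeq → Prop} (word : ∀ w, p (ellWord t w))
    (add : ∀ x y, p x → p y → p (x + y)) (smul : ∀ (a : ℂ) x, p x → p (a • x))
    {Z : EllMatSeq} (hZ : Z ∈ ellAlg t) : p Z := by
  have hZ' : Z ∈ Submodule.span ℂ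
      (Submonoid.closure (Set.range fun ε => (ellMatrix t ε : EllMatSeq)) : Set EllMatSeq) := by
    rw [← Algebra.adjoin_eq_span]
    exact hZ
  clear hZ
  induction hZ' using Submodule.span_induction with
  | mem x hx =>
    have : ∃ w, x = ellWord t w := by
      refine Submonoid.closure_induction ?_ ⟨[], rfl⟩ ?_ hx
      · rintro _ ⟨ε, rfl⟩
        exact ⟨[ε], by funext n; simp [ellWord]⟩
      · rintro x y _ _ ⟨w, rfl⟩ ⟨v, rfl⟩
        exact ⟨w ++ v, by funext n; simp [ellWord]⟩
    obtain ⟨w, rfl⟩ := this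
    exact word w
  | zero => simpa using smul 0 _ (word [])
  | add x y _ _ hx hy => exact add x y hx hy
  | smul a x _ hx => exact smul a x hx

theorem aeval_mem_ellAlg (t : ℝ) (ε : Bool) (p : Polynomial ℂ) :
    (fun n => Polynomial.aeval (ellMatrix t ε n) p : EllMatSeq) ∈ ellAlg t := by
  have h : (fun n => Polynomial.aeval (ellMatrix t ε n) p : EllMatSeq) =
      Polynomial.aeval (ellMatrix t ε : EllMatSeq) p := by
    funext n
    exact (Polynomial.aeval_algHom_apply (Pi.evalAlgHom ℂ _ n) (ellMatrix t ε : EllMatSeq) p)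
  rw [h]
  exact Algebra.adjoin_mono (Set.singleton_subset_iff.2 (Set.mem_range_self ε))
    (Polynomial.aeval_mem_adjoin_singleton _ _)

theorem ellU_mem_ellAlg (t : ℝ) (ε : Bool) (j : ℕ) : (ellU t ε j : EllMatSeq) ∈ ellAlg t :=
  aeval_mem_ellAlg t ε _

/-- The normalised expected trace. -/
noncomputable def ellMean (Z : EllMatSeq) (n : ℕ) : ℂ := (n : ℂ)⁻¹ * ellE (Z n).trace

/-- The centred trace. -/
noncomputable def ellFluct (Z : EllMatSeq) (n : ℕ) : EllPoly n := ellCen (Z n).trace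

theorem ellFluct_add (Z Z' : EllMatSeq) (n : ℕ) :
    ellFluct (Z + Z') n = ellFluct Z n + ellFluct Z' n := by
  simp [ellFluct, Matrix.trace_add]

theorem ellFluct_smul (a : ℂ) (Z : EllMatSeq) (n : ℕ) : ellFluct (a • Z) n = a • ellFluct Z n := by
  simp [ellFluct, Matrix.trace_smul]

theorem isBigO_ellE_ellFluct_mul {t : ℝ} (ht : t ∈ Set.Icc (0 : ℝ) 1) {Z Z' : EllMatSeq}
    (hZ : Z ∈ ellAlg t) (hZ' : Z' ∈ ellAlg t) :
    (fun n => ellE (ellFluct Z n * ellFluct Z' n)) =O[atTop] fun _ => (1 : ℝ) := by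
  have hc : ∀ a : ℂ, (fun _ : ℕ => a) =O[atTop] fun _ => (1 : ℝ) :=
    fun a => isBigO_const_const _ one_ne_zero _
  refine ellAlg_induction (p := fun Z => (fun n => ellE (ellFluct Z n * ellFluct Z' n))
    =O[atTop] fun _ => (1 : ℝ)) (fun w => ?_) (fun x y hx hy => ?_) (fun a x hx => ?_) hZ
  · refine ellAlg_induction (p := fun Z' => (fun n => ellE (ellFluct (ellWord t w) n *
      ellFluct Z' n)) =O[atTop] fun _ => (1 : ℝ)) (fun v => ?_) (fun x y hx hy => ?_)
      (fun a x hx => ?_) hZ'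
    · simpa [ellFluct, wordTrace] using (isBigO_wordMean_and_cenProd ht _).2 [w, v] le_rfl
    · simpa only [ellFluct_add, mul_add, map_add] using hx.add hy
    · simpa only [ellFluct_smul, mul_smul_comm, map_smul, smul_eq_mul] using (hc a).mul_one' hx
  · simpa only [ellFluct_add, add_mul, map_add] using hx.add hy
  · simpa only [ellFluct_smul, smul_mul_assoc, map_smul, smul_eq_mul] using (hc a).mul_one' hx

/-- The entrywise complex conjugation of a polynomial. -/
noncomputable abbrev ellConj {n : ℕ} : EllPoly n →+* EllPoly n :=
  MvPolynomial.map (starRingEnd ℂ)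

/-- The conjugate transpose of a sequence of matrices. -/
noncomputable def ellStar (Z : EllMatSeq) : EllMatSeq := fun n => ((Z n).map ellConj).transpose

/-- The adjoint exchanges the letters and reverses words. Closure under it turns bounds on `E [p q]`
into bounds on `E |p| ^ 2`. -/
theorem ellStar_mem_ellAlg {t : ℝ} {Z : EllMatSeq} (hZ : Z ∈ ellAlg t) : ellStar Z ∈ ellAlg t := by
  have hmul : ∀ x y : EllMatSeq, ellStar (x * y) = ellStar y * ellStar x := by
    intro x y
    funext n
    simp [ellStar, Matrix.map_mul, Matrix.transpose_mul]
  refine ellAlg_induction (p := fun Z => ellStar Z ∈ ellAlg t) (fun w => ?_)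
    (fun x y hx hy => ?_) (fun a x hx => ?_) hZ
  · induction w with
    | nil =>
      have : ellStar (ellWord t []) = 1 := by
        funext n
        simp [ellStar, ellWord, Matrix.map_one]
      rw [this]
      exact one_mem _
    | cons ε w ih =>
      have e : (ellWord t (ε :: w) : EllMatSeq) = (ellMatrix t ε : EllMatSeq) * ellWord t w := by
        funext n; simp [ellWord]
      have e' : ellStar (ellMatrix t ε) = (ellMatrix t (!ε) : EllMatSeq) := by
        funext n
        ext1 i j
        exact map_conj_ellMatrix t ε j i
      rw [e, hmul, e']
      exact mul_mem ih (ellMatrix_mem_ellAlg t _)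
  · have : ellStar (x + y) = ellStar x + ellStar y := by
      funext n
      ext1 i j
      simp [ellStar]
    rw [this]
    exact add_mem hx hy
  · have : ellStar (a • x) = (starRingEnd ℂ a) • ellStar x := by
      funext n
      ext1 i j
      simp [ellStar, MvPolynomial.smul_eq_C_mul]
    rw [this]
    exact Subalgebra.smul_mem _ hx _

theorem ellE_ellConj {n : ℕ} (p : EllPoly n) : ellE (ellConj p) = starRingEnd ℂ (ellE p) := by
  rw [ellE_apply, ellE_apply, ← integral_conj]
  simp only [conj_realEval]

theorem ellConj_ellFluct (Z : EllMatSeq) (n : ℕ) :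
    ellConj (ellFluct Z n) = ellFluct (ellStar Z) n := by
  have : (ellStar Z n).trace = ellConj (Z n).trace := by
    simp [ellStar, Matrix.trace]
  rw [ellFluct, ellFluct, this, ellCen_apply, ellCen_apply, map_sub, ellE_ellConj]
  simp

/-- The mean of `|p| ^ 2`. -/
noncomputable def ellSq {n : ℕ} (p : EllPoly n) : ℝ :=
  ∫ g, ‖realEval g p‖ ^ 2 ∂stdGaussianPi (EllIndex n)

/-- The mean of `|p|`. -/
noncomputable def ellL1 {n : ℕ} (p : EllPoly n) : ℝ :=
  ∫ g, ‖realEval g p‖ ∂stdGaussianPi (EllIndex n)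

theorem integrable_norm_realEval_sq {n : ℕ} (p : EllPoly n) :
    Integrable (fun g => ‖realEval g p‖ ^ 2) (stdGaussianPi (EllIndex n)) := by
  have := (integrable_realEval (p * ellConj p)).norm
  refine this.congr (ae_of_all _ fun g => ?_)
  simp [← conj_realEval, sq]

theorem ofReal_ellSq {n : ℕ} (p : EllPoly n) : (ellSq p : ℂ) = ellE (p * ellConj p) := by
  rw [ellSq, ← integral_complex_ofReal, ellE_apply]
  congr 1
  ext g
  rw [map_mul, ← conj_realEval, Complex.mul_conj, Complex.normSq_eq_norm_sq]

theorem ellL1_nonneg {n : ℕ} (p : EllPoly n) : 0 ≤ ellL1 p := integral_nonneg fun _ => norm_nonneg _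

theorem ellL1_add_le {n : ℕ} (p q : EllPoly n) : ellL1 (p + q) ≤ ellL1 p + ellL1 q := by
  rw [ellL1, ellL1, ellL1, ← integral_add (integrable_realEval p).norm (integrable_realEval q).norm]
  refine integral_mono (integrable_realEval _).norm
    ((integrable_realEval p).norm.add (integrable_realEval q).norm) fun g => ?_
  simpa using norm_add_le (realEval g p) (realEval g q)

theorem ellL1_smul {n : ℕ} (a : ℂ) (p : EllPoly n) : ellL1 (a • p) = ‖a‖ * ellL1 p := by
  simp [ellL1, integral_const_mul]

theorem ellL1_C {n : ℕ} (a : ℂ) : ellL1 (MvPolynomial.C a : EllPoly n) = ‖a‖ := by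
  simp [ellL1]

theorem ellL1_mul_le {n : ℕ} (p q : EllPoly n) : ellL1 (p * q) ≤ ellSq p + ellSq q := by
  rw [ellL1, ellSq, ellSq,
    ← integral_add (integrable_norm_realEval_sq p) (integrable_norm_realEval_sq q)]
  refine integral_mono (integrable_realEval _).norm
    ((integrable_norm_realEval_sq p).add (integrable_norm_realEval_sq q)) fun g => ?_
  simp only [map_mul, norm_mul]
  nlinarith [sq_nonneg (‖realEval g p‖ - ‖realEval g q‖), sq_nonneg ‖realEval g p‖,
    sq_nonneg ‖realEval g q‖]

theorem ellL1_le {n : ℕ} (p : EllPoly n) : ellL1 p ≤ ellSq p + 1 := by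
  have := ellL1_mul_le p 1
  simpa [ellSq] using this

theorem isBigO_ellSq_ellFluct {t : ℝ} (ht : t ∈ Set.Icc (0 : ℝ) 1) {Z : EllMatSeq}
    (hZ : Z ∈ ellAlg t) : (fun n => ellSq (ellFluct Z n)) =O[atTop] fun _ => (1 : ℝ) := by
  have := (isBigO_ellE_ellFluct_mul ht hZ (ellStar_mem_ellAlg hZ)).norm_left
  refine (this.congr_left fun n => ?_).of_norm_left
  rw [← ellConj_ellFluct, ← ofReal_ellSq, Complex.norm_real]

theorem isBigO_ellL1_ellFluct {t : ℝ} (ht : t ∈ Set.Icc (0 : ℝ) 1) {Z : EllMatSeq}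
    (hZ : Z ∈ ellAlg t) : (fun n => ellL1 (ellFluct Z n)) =O[atTop] fun _ => (1 : ℝ) := by
  refine IsBigO.trans (IsBigO.of_bound 1 (Eventually.of_forall fun n => ?_))
    ((isBigO_ellSq_ellFluct ht hZ).add (isBigO_refl (fun _ => (1 : ℝ)) _))
  rw [one_mul, Real.norm_of_nonneg (ellL1_nonneg _)]
  exact (ellL1_le _).trans (le_abs_self _)

/-- A sequence of polynomials tending to `0` in mean. -/
def EllNull (p : (n : ℕ) → EllPoly n) : Prop := Tendsto (fun n => ellL1 (p n)) atTop (𝓝 0)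

theorem EllNull.add {p q : (n : ℕ) → EllPoly n} (hp : EllNull p) (hq : EllNull q) :
    EllNull fun n => p n + q n := by
  refine squeeze_zero (fun n => ellL1_nonneg _) (fun n => ellL1_add_le _ _) ?_
  simpa using Tendsto.add hp hq

theorem ellNull_zero : EllNull fun _ => 0 := by
  simp [EllNull, ellL1]

theorem EllNull.sum {ι : Type*} {s : Finset ι} {p : ι → (n : ℕ) → EllPoly n}
    (h : ∀ i ∈ s, EllNull (p i)) : EllNull fun n => ∑ i ∈ s, p i n := by
  classical
  induction s using Finset.induction_on with
  | empty => simpa using ellNull_zero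
  | insert a s ha ih =>
    simp only [sum_insert ha]
    exact (h a (by simp)).add (ih fun i hi => h i (by simp [hi]))

theorem EllNull.of_tendsto_smul {a : ℕ → ℂ} {p : (n : ℕ) → EllPoly n}
    (ha : Tendsto a atTop (𝓝 0)) (hp : (fun n => ellL1 (p n)) =O[atTop] fun _ => (1 : ℝ)) :
    EllNull fun n => a n • p n := by
  have h := (((isLittleO_one_iff ℝ).2 ha).norm_left.mul_isBigO hp)
  simp only [mul_one] at h
  have := (isLittleO_one_iff ℝ).1 h
  simpa only [EllNull, ellL1_smul] using this

theorem EllNull.smul {p : (n : ℕ) → EllPoly n} (hp : EllNull p) (a : ℂ) :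
    EllNull fun n => a • p n := by
  simpa [EllNull, ellL1_smul] using Tendsto.const_mul ‖a‖ hp

theorem ellNull_C {a : ℕ → ℂ} (ha : Tendsto a atTop (𝓝 0)) :
    EllNull fun n => MvPolynomial.C (a n) := by
  simpa [EllNull, ellL1_C] using ha.norm

/-- Normalised traces concentrate: the centred trace is bounded in mean, so division by `n` kills
it. -/
theorem ellNull_trace_sub {t : ℝ} (ht : t ∈ Set.Icc (0 : ℝ) 1) {Z : EllMatSeq}
    (hZ : Z ∈ ellAlg t) {z : ℂ} (hz : Tendsto (ellMean Z) atTop (𝓝 z)) :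
    EllNull fun n => (n : ℂ)⁻¹ • (Z n).trace - MvPolynomial.C z := by
  have h1 := EllNull.of_tendsto_smul (tendsto_inv_atTop_nhds_zero_nat (𝕜 := ℂ))
    (isBigO_ellL1_ellFluct ht hZ)
  have h2 := ellNull_C (tendsto_sub_nhds_zero_iff.2 hz)
  convert h1.add h2 using 2 with n
  rw [ellFluct, ellCen_apply, ellMean]
  simp [MvPolynomial.smul_eq_C_mul, mul_sub]

theorem tendsto_ellE_trace_mul_trace {t : ℝ} (ht : t ∈ Set.Icc (0 : ℝ) 1) {Z Z' : EllMatSeq}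
    (hZ : Z ∈ ellAlg t) (hZ' : Z' ∈ ellAlg t) {z z' : ℂ} (hz : Tendsto (ellMean Z) atTop (𝓝 z))
    (hz' : Tendsto (ellMean Z') atTop (𝓝 z')) :
    Tendsto (fun n : ℕ => (n : ℂ)⁻¹ * ((n : ℂ)⁻¹ * ellE ((Z n).trace * (Z' n).trace))) atTop
      (𝓝 (z * z')) := by
  have h0 := tendsto_inv_atTop_nhds_zero_nat (𝕜 := ℂ)
  have h1 : Tendsto (fun n : ℕ => (n : ℂ)⁻¹ * (n : ℂ)⁻¹ * ellE (ellFluct Z n * ellFluct Z' n))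
      atTop (𝓝 0) := by
    have h3 := h0.mul h0
    rw [mul_zero] at h3
    have h2 := ((isLittleO_one_iff ℝ).2 h3).mul_isBigO (isBigO_ellE_ellFluct_mul ht hZ hZ')
    simp only [mul_one] at h2
    exact (isLittleO_one_iff ℝ).1 h2
  have := (hz.mul hz').add h1
  rw [add_zero] at this
  refine this.congr fun n => ?_
  rw [ellE_mul (Z n).trace, ellMean, ellMean, ellFluct, ellFluct]
  ring

end WordAlgebra

/-! ### Asymptotic orthogonality of the second-kind polynomials. -/

section Limits

open Finset Asymptotics Topology

variable {t : ℝ}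

/-- The limit of the normalised expected trace of a product of two Chebyshev polynomials. -/
noncomputable def ellLim (t : ℝ) (ε δ : Bool) (j k : ℕ) : ℂ := if j = k then ellCov t ε δ ^ k else 0

theorem ellLim_succ_succ (ε δ : Bool) (j k : ℕ) :
    ellLim t ε δ (j + 1) (k + 1) = ellCov t ε δ * ellLim t ε δ j k := by
  by_cases h : j = k <;> simp [ellLim, h, pow_succ']

/-- The products of two Chebyshev polynomials. -/
noncomputable def ellUU (t : ℝ) (ε δ : Bool) (j k : ℕ) : EllMatSeq :=
  fun n => ellU t ε j n * ellU t δ k n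

theorem ellUU_mem_ellAlg (t : ℝ) (ε δ : Bool) (j k : ℕ) : ellUU t ε δ j k ∈ ellAlg t :=
  mul_mem (ellU_mem_ellAlg t ε j) (ellU_mem_ellAlg t δ k)

theorem ellUU_zero_right (t : ℝ) (ε δ : Bool) (j : ℕ) : ellUU t ε δ j 0 = ellU t ε j := by
  funext n; simp [ellUU]

theorem ellMean_ellUU_comm (t : ℝ) (ε δ : Bool) (j k : ℕ) :
    ellMean (ellUU t ε δ j k) = ellMean (ellUU t δ ε k j) := by
  funext n
  simp only [ellMean, ellUU, Matrix.trace_mul_comm (ellU t ε j n)]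

theorem ellE_trace_ellMatrix_mul_ellUU (ht : t ∈ Set.Icc (0 : ℝ) 1) (ε δ : Bool) (j k n : ℕ) :
    ellE (ellMatrix t ε n * ellUU t ε δ j k n).trace =
      (n : ℂ)⁻¹ * ∑ r ∈ range j,
        t * ellE ((ellU t ε r n).trace * (ellUU t ε δ (j - 1 - r) k n).trace) +
      (n : ℂ)⁻¹ * ∑ r ∈ range k, ellCov t ε δ *
        ellE ((ellUU t ε δ j r n).trace * (ellU t δ (k - 1 - r) n).trace) := by
  have h := ellE_trace_ellMatrix_mul t ε (ellUU t ε δ j k n) 1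
  rw [mul_one, mul_one, Derivation.map_one_eq_zero, add_zero] at h
  rw [h, ellUU, (isSplit_ellU ht ε ε j).ellDiv_mul (isSplit_ellU ht ε δ k)]
  simp only [map_add, map_smul, map_sum, smul_eq_mul, ellCov_self, ellUU]

/-- Induction on `j + k`, by the loop equation for `X U_j(ε) U_k(δ)`. Contraction inside `U_j`
leaves only `r = 0`, which the term `- t U_{j-1}` of the recurrence cancels. Contraction with `U_k`
leaves only `r = k - 1`. The limit at `(j + 1, k)` is thus `ellCov t ε δ` times the limit at `(j, k
- 1)`, or zero if `k = 0`. -/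
theorem tendsto_ellMean_ellUU (ht : t ∈ Set.Icc (0 : ℝ) 1) (ε δ : Bool) (j k : ℕ) :
    Tendsto (ellMean (ellUU t ε δ j k)) atTop (𝓝 (ellLim t ε δ j k)) := by
  obtain ⟨N, hN⟩ : ∃ N, N = j + k := ⟨_, rfl⟩
  induction N using Nat.strong_induction_on generalizing ε δ j k with
  | _ N ih =>
  have IH : ∀ (ε δ : Bool) (j k : ℕ), j + k < N →
      Tendsto (ellMean (ellUU t ε δ j k)) atTop (𝓝 (ellLim t ε δ j k)) :=
    fun ε δ j k h => ih _ h ε δ j k rfl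
  have IH0 : ∀ (ε : Bool) (j : ℕ), j < N →
      Tendsto (ellMean (ellU t ε j)) atTop (𝓝 (if j = 0 then 1 else 0)) := by
    intro ε j h
    have := IH ε ε j 0 h
    rwa [ellUU_zero_right, ellLim, pow_zero] at this
  have main : ∀ (ε δ : Bool) (j k : ℕ), N = j + 1 + k →
      Tendsto (ellMean (ellUU t ε δ (j + 1) k)) atTop (𝓝 (ellLim t ε δ (j + 1) k)) := by
    intro ε δ j k hN
    have h1 : Tendsto (fun n : ℕ => (n : ℂ)⁻¹ * ellE (ellMatrix t ε n * ellUU t ε δ j k n).trace)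
        atTop (𝓝 (∑ r ∈ range j, (t : ℂ) * ((if r = 0 then 1 else 0) *
            ellLim t ε δ (j - 1 - r) k) +
          ∑ r ∈ range k, ellCov t ε δ * (ellLim t ε δ j r * if k - 1 - r = 0 then 1 else 0))) := by
      refine Tendsto.congr (fun n => by rw [ellE_trace_ellMatrix_mul_ellUU ht, mul_add])
        (Tendsto.add ?_ ?_)
      · simp only [mul_sum]
        refine tendsto_finsetSum _ fun r hr => ?_
        rw [mem_range] at hr
        refine (tendsto_const_nhds.mul (tendsto_ellE_trace_mul_trace ht (ellU_mem_ellAlg t ε r)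
          (ellUU_mem_ellAlg t ε δ (j - 1 - r) k) (IH0 ε r (by omega))
          (IH ε δ (j - 1 - r) k (by omega)))).congr fun n => by ring
      · simp only [mul_sum]
        refine tendsto_finsetSum _ fun r hr => ?_
        rw [mem_range] at hr
        refine (tendsto_const_nhds.mul (tendsto_ellE_trace_mul_trace ht
          (ellUU_mem_ellAlg t ε δ j r) (ellU_mem_ellAlg t δ (k - 1 - r)) (IH ε δ j r (by omega))
          (IH0 δ (k - 1 - r) (by omega)))).congr fun n => by ring
    have e2 : ∑ r ∈ range k, ellCov t ε δ * (ellLim t ε δ j r * if k - 1 - r = 0 then 1 else 0) =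
        ellLim t ε δ (j + 1) k := by
      cases k with
      | zero => simp [ellLim]
      | succ k =>
        rw [sum_range_succ, sum_eq_zero, ellLim_succ_succ]
        · simp
        · intro r hr
          rw [mem_range] at hr
          have : k + 1 - 1 - r ≠ 0 := by omega
          rw [if_neg this, mul_zero, mul_zero]
    rw [e2] at h1
    cases j with
    | zero =>
      simp only [range_zero, sum_empty, zero_add] at h1
      refine h1.congr fun n => ?_
      simp [ellMean, ellUU, ellU_one]
    | succ j =>
      have e1 : ∑ r ∈ range (j + 1), (t : ℂ) * ((if r = 0 then 1 else 0) *
          ellLim t ε δ (j + 1 - 1 - r) k) = t * ellLim t ε δ j k := by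
        rw [sum_range_succ', sum_eq_zero]
        · simp
        · simp
      rw [e1] at h1
      have h2 := h1.sub ((IH ε δ j k (by omega)).const_mul (t : ℂ))
      rw [add_sub_cancel_left] at h2
      refine h2.congr fun n => ?_
      simp only [ellMean, ellUU, ellU_add_two, sub_mul, smul_mul_assoc, Matrix.trace_sub, map_sub,
        Matrix.trace_smul, map_smul, smul_eq_mul, mul_assoc]
      ring
  match j, k, hN with
  | 0, 0, _ =>
    refine (tendsto_const_nhds (x := (1 : ℂ))).congr' ?_ |>.trans_eq ?_
    · filter_upwards [eventually_ne_atTop 0] with n hn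
      have h : ellE (n : EllPoly n) = n := by simpa using ellE_C (n := n) (n : ℂ)
      simp [ellMean, ellUU, h, hn]
    · simp [ellLim]
  | j + 1, k, hN => exact main ε δ j k hN
  | 0, k + 1, hN =>
    rw [ellMean_ellUU_comm]
    have := main δ ε k 0 (by omega)
    simpa [ellLim] using this

end Limits

/-! ### The loop equation for first-kind traces. -/

section Fluctuations

open Finset Asymptotics Topology

variable {t : ℝ}

/-- The Chebyshev polynomial of the first kind of degree `k` in the letter `ε`. -/
noncomputable def ellP (t : ℝ) (ε : Bool) (k : ℕ) : EllMatSeq :=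
  fun n => Polynomial.aeval (ellMatrix t ε n) (Polynomial.dickson 1 (t : ℂ) k)

/-- The remainder in the loop equation for the centred trace of a Chebyshev polynomial. -/
noncomputable def ellRem (t : ℝ) (ε : Bool) (k n : ℕ) : EllPoly n :=
  ellCen (ellDiv t ε (ellU t ε k n)) - (if k = 0 then 0 else
    (2 * t : ℂ) • ellFluct (ellU t ε (k - 1)) n)

/-- The loop equation with the phase handles the trace of `X U_k`, and the one without it handles
its mean. The term `- 2 t U_{k-1}` of the first-kind polynomial is absorbed in the remainder. -/
theorem phaseExp_ellFluct_ellP {n : ℕ} {q : EllPoly n} (hq : IsPhase q) (ε : Bool) (k : ℕ) :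
    phaseExp hq (ellFluct (ellP t ε (k + 1)) n) =
      phaseExp hq (ellRem t ε k n) + phaseExp hq (ellGrad t ε (ellU t ε k n) q) := by
  have h0 := phaseExp_trace_ellMatrix_mul t hq ε (ellU t ε k n) 1
  have h1 := ellE_trace_ellMatrix_mul t ε (ellU t ε k n) 1
  rw [mul_one, mul_one, Derivation.map_one_eq_zero, add_zero, one_mul] at h0
  rw [mul_one, mul_one, Derivation.map_one_eq_zero, add_zero] at h1
  have h2 : phaseExp hq (ellCen (ellMatrix t ε n * ellU t ε k n).trace) =
      phaseExp hq (ellCen (ellDiv t ε (ellU t ε k n))) +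
        phaseExp hq (ellGrad t ε (ellU t ε k n) q) := by
    rw [ellCen_apply, ellCen_apply, map_sub, map_sub, h0, h1, map_add]
    ring
  cases k with
  | zero =>
    have : ellP t ε (0 + 1) n = ellMatrix t ε n * ellU t ε 0 n := by simp [ellP]
    rw [ellFluct, this, h2]
    simp [ellRem]
  | succ k =>
    have : ellP t ε (k + 1 + 1) n = ellMatrix t ε n * ellU t ε (k + 1) n -
        (2 * t : ℂ) • ellU t ε k n := by
      rw [ellP, dickson_one_add_two_eq, map_sub, map_mul _ Polynomial.X,
        map_mul _ (Polynomial.C _), Polynomial.aeval_X, Polynomial.aeval_C, ← Algebra.smul_def,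
        ellU, ellU]
    rw [ellFluct, this, Matrix.trace_sub, map_sub, map_sub, h2, ellRem]
    simp [Matrix.trace_smul, ellFluct]
    ring

theorem ellCen_mul {n : ℕ} (p q : EllPoly n) :
    ellCen (p * q) = ellCen p * ellCen q - MvPolynomial.C (ellE (ellCen p * ellCen q))
      + ellE p • ellCen q + ellE q • ellCen p := by
  rw [ellCen_apply (p * q), ellE_mul]
  simp only [ellCen_apply, MvPolynomial.smul_eq_C_mul, map_add, map_mul]
  ring

/-- Centring `1 / n` times a product of traces leaves a quadratic term of order `1 / n` and two
terms of the form normalised mean times centred trace. The normalised mean of `U_r` tends to `0`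
unless `r = 0`, so only the two ends of the sum survive, and the subtracted `2 t` term removes them.
-/
theorem ellNull_ellRem (ht : t ∈ Set.Icc (0 : ℝ) 1) (ε : Bool) (k : ℕ) :
    EllNull (ellRem t ε k) := by
  have h0 := tendsto_inv_atTop_nhds_zero_nat (𝕜 := ℂ)
  have hdiv : ∀ n, ellDiv t ε (ellU t ε k n) = (n : ℂ)⁻¹ • ∑ r ∈ range k,
      (t : ℂ) • ((ellU t ε r n).trace * (ellU t ε (k - 1 - r) n).trace) := by
    intro n
    simpa using (isSplit_ellU ht ε ε k (n := n)).ellDiv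
  cases k with
  | zero =>
    have : ellRem t ε 0 = fun n => 0 := by
      funext n; rw [ellRem, hdiv]; simp
    rw [this]; exact ellNull_zero
  | succ k =>
    have hm : ∀ r, Tendsto (fun n => ellMean (ellU t ε r) n - if r = 0 then 1 else 0) atTop
        (𝓝 0) := by
      intro r
      have := tendsto_ellMean_ellUU ht ε ε r 0
      rw [ellUU_zero_right, ellLim, pow_zero] at this
      exact tendsto_sub_nhds_zero_iff.2 this
    have hA : ∀ r, ellU t ε r ∈ ellAlg t := ellU_mem_ellAlg t ε
    have hF : ∀ r, (fun n => ellL1 (ellFluct (ellU t ε r) n)) =O[atTop] fun _ => (1 : ℝ) :=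
      fun r => isBigO_ellL1_ellFluct ht (hA r)
    have h1 : ∀ r s, EllNull fun n => (n : ℂ)⁻¹ • (ellFluct (ellU t ε r) n *
        ellFluct (ellU t ε s) n) := by
      intro r s
      refine EllNull.of_tendsto_smul h0 ?_
      refine IsBigO.trans (IsBigO.of_bound 1 (Eventually.of_forall fun n => ?_))
        ((isBigO_ellSq_ellFluct ht (hA r)).add (isBigO_ellSq_ellFluct ht (hA s)))
      rw [one_mul, Real.norm_of_nonneg (ellL1_nonneg _)]
      exact (ellL1_mul_le _ _).trans (le_abs_self _)
    have h2 : ∀ r s, EllNull fun n => MvPolynomial.C (-((n : ℂ)⁻¹ *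
        ellE (ellFluct (ellU t ε r) n * ellFluct (ellU t ε s) n))) := by
      intro r s
      refine ellNull_C ?_
      have h3 := ((isLittleO_one_iff ℝ).2 h0).mul_isBigO
        (isBigO_ellE_ellFluct_mul ht (hA r) (hA s))
      simp only [mul_one] at h3
      simpa using ((isLittleO_one_iff ℝ).1 h3).neg
    have h3 : ∀ r s, EllNull fun n => (ellMean (ellU t ε r) n - if r = 0 then 1 else 0) •
        ellFluct (ellU t ε s) n := fun r s => EllNull.of_tendsto_smul (hm r) (hF s)
    have h4 : EllNull fun n => ∑ r ∈ range (k + 1), (t : ℂ) • (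
        ((((n : ℂ)⁻¹ • (ellFluct (ellU t ε r) n * ellFluct (ellU t ε (k - r)) n)) +
          MvPolynomial.C (-((n : ℂ)⁻¹ *
            ellE (ellFluct (ellU t ε r) n * ellFluct (ellU t ε (k - r)) n)))) +
        (ellMean (ellU t ε r) n - if r = 0 then 1 else 0) • ellFluct (ellU t ε (k - r)) n) +
        (ellMean (ellU t ε (k - r)) n - if k - r = 0 then 1 else 0) • ellFluct (ellU t ε r) n) :=
      EllNull.sum fun r _ => ((((h1 _ _).add (h2 _ _)).add (h3 _ _)).add (h3 _ _)).smul _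
    convert h4 using 2 with n
    rw [ellRem, hdiv, map_smul, map_sum]
    -- The limiting means select `r = 0` and `r = k`, each contributing `t` times the same
    -- fluctuation.
    have e : ∀ F : ℕ → EllPoly n, ∑ r ∈ range (k + 1), (t : ℂ) • (F r +
        (if r = 0 then (1 : ℂ) else 0) • ellFluct (ellU t ε (k - r)) n +
        (if k - r = 0 then (1 : ℂ) else 0) • ellFluct (ellU t ε r) n) =
        ∑ r ∈ range (k + 1), (t : ℂ) • F r + (2 * t : ℂ) • ellFluct (ellU t ε k) n := by
      intro F
      have e1 : ∑ r ∈ range (k + 1), (t : ℂ) • (if r = 0 then (1 : ℂ) else 0) •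
          ellFluct (ellU t ε (k - r)) n = (t : ℂ) • ellFluct (ellU t ε k) n := by
        rw [sum_eq_single 0] <;> simp +contextual
      have e2 : ∑ r ∈ range (k + 1), (t : ℂ) • (if k - r = 0 then (1 : ℂ) else 0) •
          ellFluct (ellU t ε r) n = (t : ℂ) • ellFluct (ellU t ε k) n := by
        rw [sum_eq_single k]
        · simp
        · intro r hr hrk
          rw [mem_range] at hr
          have : k - r ≠ 0 := by omega
          simp [this]
        · simp
      simp only [smul_add, sum_add_distrib, e1, e2, add_assoc, two_mul, add_smul]
    rw [if_neg (Nat.succ_ne_zero k), Nat.add_sub_cancel, sub_eq_iff_eq_add, ← e, smul_sum]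
    refine sum_congr rfl fun r _ => ?_
    rw [map_smul, smul_comm, ellCen_mul]
    congr 1
    simp only [sub_smul, MvPolynomial.C_neg, map_mul, smul_add, smul_sub, ellMean, mul_smul,
      ellFluct, MvPolynomial.smul_eq_C_mul]
    ring

end Fluctuations

/-! ### Convergence of characteristic functions through a differential equation. -/

section CharacteristicFunction

open Finset Asymptotics Topology

/-- Stability of the differential equation `φ' = - s v φ` of a Gaussian characteristic function. -/
theorem norm_sub_exp_le_of_hasDerivAt {φ φ' : ℝ → ℂ} {v : ℂ} {a : ℝ}
    (hφ : ∀ s, HasDerivAt φ (φ' s) s) (h0 : φ 0 = 1)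
    (h : ∀ s ∈ Set.Ico (0 : ℝ) 1, ‖φ' s + s * v * φ s‖ ≤ a) :
    ‖φ 1 - Complex.exp (-(v / 2))‖ ≤ a * Real.exp ‖v‖ * Real.exp ‖v‖ := by
  have hexp : ∀ z : ℂ, ‖z‖ ≤ ‖v‖ → ‖Complex.exp z‖ ≤ Real.exp ‖v‖ := fun z hz => by
    rw [Complex.norm_exp]
    exact Real.exp_le_exp.2 ((Complex.re_le_norm z).trans hz)
  -- Integrating factor: the derivative of the product is exactly the defect times the exponential.
  have hF : ∀ s : ℝ, HasDerivAt (fun s : ℝ => φ s * Complex.exp ((s : ℂ) ^ 2 * v / 2))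
      ((φ' s + s * v * φ s) * Complex.exp ((s : ℂ) ^ 2 * v / 2)) s := by
    intro s
    have h1 : HasDerivAt (fun s : ℝ => (s : ℂ) ^ 2 * v / 2) (s * v) s := by
      have := (((Complex.ofRealCLM.hasDerivAt (x := s)).pow 2).mul_const v).div_const 2
      refine this.congr_deriv ?_
      simp
      ring
    refine ((hφ s).mul h1.cexp).congr_deriv ?_
    ring
  have hle : ∀ s : ℝ, s ∈ Set.Icc (0 : ℝ) 1 → ‖(s : ℂ) ^ 2 * v / 2‖ ≤ ‖v‖ := by
    intro s hs
    have h1 : ‖(s : ℂ)‖ ^ 2 ≤ 1 := by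
      rw [Complex.norm_real, Real.norm_eq_abs, abs_of_nonneg hs.1]
      nlinarith [hs.1, hs.2]
    rw [norm_div, norm_mul, norm_pow, RCLike.norm_ofNat]
    nlinarith [norm_nonneg v, mul_le_mul_of_nonneg_right h1 (norm_nonneg v)]
  have key := norm_image_sub_le_of_norm_deriv_le_segment_01'
    (fun s _ => (hF s).hasDerivWithinAt) (C := a * Real.exp ‖v‖) fun s hs => by
      rw [norm_mul]
      exact mul_le_mul (h s hs) (hexp _ (hle s ⟨hs.1, hs.2.le⟩)) (norm_nonneg _)
        ((norm_nonneg _).trans (h s hs))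
  have e : φ 1 - Complex.exp (-(v / 2)) = (φ 1 * Complex.exp (((1 : ℝ) : ℂ) ^ 2 * v / 2) -
      φ 0 * Complex.exp (((0 : ℝ) : ℂ) ^ 2 * v / 2)) * Complex.exp (-(v / 2)) := by
    rw [h0, sub_mul, mul_assoc, ← Complex.exp_add]
    simp
  rw [e, norm_mul]
  refine mul_le_mul key (hexp _ ?_) (norm_nonneg _) ((norm_nonneg _).trans key)
  rw [norm_neg, norm_div, RCLike.norm_ofNat]
  linarith [norm_nonneg v]

theorem hasDerivAt_phaseExp_one {ι : Type*} [Fintype ι] {w : MvPolynomial ι ℂ}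
    (hq : ∀ s : ℝ, IsPhase ((Complex.I * s) • w)) (s : ℝ) :
    HasDerivAt (fun s => phaseExp (hq s) 1) (phaseExp (hq s) (Complex.I • w)) s := by
  have h := hasDerivAt_integral_of_dominated_loc_of_deriv_le (μ := stdGaussianPi ι)
    (F := fun (s : ℝ) g => realEval g 1 * Complex.exp (realEval g ((Complex.I * s) • w)))
    (F' := fun (s : ℝ) g => realEval g (Complex.I • w) *
      Complex.exp (realEval g ((Complex.I * s) • w)))
    (x₀ := s) (s := Set.univ) (bound := fun g => ‖realEval g (Complex.I • w)‖) univ_mem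
    (Eventually.of_forall fun s => ((hq s).integrable 1).aestronglyMeasurable)
    ((hq s).integrable 1) ((hq s).integrable _).aestronglyMeasurable
    (ae_of_all _ fun g s _ => by rw [norm_mul, (hq s).norm_exp, mul_one])
    (integrable_realEval _).norm
    (ae_of_all _ fun g s _ => by
      have h1 : HasDerivAt (fun s : ℝ => realEval g ((Complex.I * s) • w))
          (realEval g (Complex.I • w)) s := by
        have := ((Complex.ofRealCLM.hasDerivAt (x := s)).const_mul Complex.I).mul_const
          (realEval g w)
        simp only [map_smul, smul_eq_mul]
        refine this.congr_deriv ?_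
        simp
      refine (h1.cexp.const_mul (realEval g 1)).congr_deriv ?_
      rw [map_one]
      ring)
  exact h.2

variable {t : ℝ}

/-- A linear combination of the centred traces of Chebyshev polynomials. -/
noncomputable def ellLin (t : ℝ) (η : Bool → ℕ → ℂ) (m n : ℕ) : EllPoly n :=
  ∑ ε, ∑ k ∈ range m, η ε k • ellFluct (ellP t ε (k + 1)) n

theorem map_ellLin (t : ℝ) (η : Bool → ℕ → ℂ) (m : ℕ) {n : ℕ} (f : EllPoly n →ₗ[ℂ] ℂ) :
    f (ellLin t η m n) = ∑ ε, ∑ k ∈ range m, η ε k * f (ellFluct (ellP t ε (k + 1)) n) := by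
  simp only [ellLin, map_sum, map_smul, smul_eq_mul]

theorem ellGrad_ellLin (ht : t ∈ Set.Icc (0 : ℝ) 1) (η : Bool → ℕ → ℂ) (m n : ℕ) (ε : Bool)
    (k : ℕ) : ellGrad t ε (ellU t ε k n) (ellLin t η m n) = ∑ δ, ∑ l ∈ range m,
      (η δ l * (ellCov t ε δ * (l + 1))) • ((n : ℂ)⁻¹ • (ellUU t ε δ k l n).trace) := by
  simp only [ellLin, map_sum, Derivation.map_smul]
  refine sum_congr rfl fun δ _ => sum_congr rfl fun l _ => ?_
  rw [ellFluct, ellGrad_ellCen, ellP, ellGrad_trace_aeval ht, derivative_dickson_one, map_mul,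
    map_natCast, ← nsmul_eq_mul, mul_smul_comm, Matrix.trace_smul, ← Nat.cast_smul_eq_nsmul ℂ,
    smul_smul, smul_smul, smul_smul]
  congr 1
  push_cast
  ring

/-- The covariance of the limit of `ellLin t η m` with the limit of the trace of the Chebyshev
polynomial of degree `k + 1` in the letter `ε`. -/
noncomputable def ellLinCov (t : ℝ) (η : Bool → ℕ → ℂ) (ε : Bool) (k : ℕ) : ℂ :=
  ∑ δ, η δ k * ((k + 1) * ellCov t ε δ ^ (k + 1))

/-- The gradient is a combination of normalised traces of `U_k(ε) U_l(δ)`. These concentrate, and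
orthogonality keeps only `l = k`. -/
theorem ellNull_ellGrad_ellLin (ht : t ∈ Set.Icc (0 : ℝ) 1) (η : Bool → ℕ → ℂ) (m : ℕ) (ε : Bool)
    {k : ℕ} (hk : k < m) :
    EllNull fun n => ellGrad t ε (ellU t ε k n) (ellLin t η m n) -
      MvPolynomial.C (ellLinCov t η ε k) := by
  have h : EllNull fun n => ∑ δ, ∑ l ∈ range m, (η δ l * (ellCov t ε δ * (l + 1))) •
      ((n : ℂ)⁻¹ • (ellUU t ε δ k l n).trace - MvPolynomial.C (ellLim t ε δ k l)) :=
    EllNull.sum fun δ _ => EllNull.sum fun l _ => (ellNull_trace_sub ht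
      (ellUU_mem_ellAlg t ε δ k l) (tendsto_ellMean_ellUU ht ε δ k l)).smul _
  convert h using 2 with n
  have e : ellLinCov t η ε k = ∑ δ, ∑ l ∈ range m,
      (η δ l * (ellCov t ε δ * (l + 1))) * ellLim t ε δ k l := by
    refine sum_congr rfl fun δ _ => ?_
    rw [sum_eq_single k]
    · simp [ellLim, pow_succ]; ring
    · intro l _ hl
      simp [ellLim, hl.symm]
    · intro h; exact absurd (mem_range.2 hk) h
  rw [ellGrad_ellLin ht, e, map_sum, ← sum_sub_distrib]
  refine sum_congr rfl fun δ _ => ?_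
  rw [map_sum, ← sum_sub_distrib]
  refine sum_congr rfl fun l _ => ?_
  rw [smul_sub, map_mul, MvPolynomial.smul_eq_C_mul (MvPolynomial.C _)]

/-- The limiting variance of `ellLin t η m`. -/
noncomputable def ellLinVar (t : ℝ) (η : Bool → ℕ → ℂ) (m : ℕ) : ℂ :=
  ∑ ε, ∑ k ∈ range m, η ε k * ellLinCov t η ε k

/-- The phase has modulus one, so the defect in `φ' = - s v φ` is at most the mean size of the
errors `R` (remainders) and `S` (gradients), uniformly in `s ∈ [0, 1]`. -/
theorem tendsto_phaseExp_ellLin (ht : t ∈ Set.Icc (0 : ℝ) 1) (η : Bool → ℕ → ℂ) (m : ℕ)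
    (hq : ∀ (n : ℕ) (s : ℝ), IsPhase ((Complex.I * s) • ellLin t η m n)) :
    Tendsto (fun n => phaseExp (hq n 1) 1) atTop (𝓝 (Complex.exp (-(ellLinVar t η m / 2)))) := by
  set R : (n : ℕ) → EllPoly n := fun n => ∑ ε, ∑ k ∈ range m, η ε k • ellRem t ε k n with hR
  set S : (n : ℕ) → EllPoly n := fun n => ∑ ε, ∑ k ∈ range m, η ε k •
    (ellGrad t ε (ellU t ε k n) (ellLin t η m n) - MvPolynomial.C (ellLinCov t η ε k)) with hS
  have hRn : EllNull R := EllNull.sum fun ε _ => EllNull.sum fun k _ =>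
    (ellNull_ellRem ht ε k).smul _
  have hSn : EllNull S := EllNull.sum fun ε _ => EllNull.sum fun k hk =>
    (ellNull_ellGrad_ellLin ht η m ε (mem_range.1 hk)).smul _
  have hder : ∀ (n : ℕ) (s : ℝ), phaseExp (hq n s) (Complex.I • ellLin t η m n) +
      s * ellLinVar t η m * phaseExp (hq n s) 1 =
      Complex.I * phaseExp (hq n s) (R n) - s * phaseExp (hq n s) (S n) := by
    intro n s
    have h1 : phaseExp (hq n s) (ellLin t η m n) = phaseExp (hq n s) (R n) + Complex.I * s *
        (phaseExp (hq n s) (S n) + ellLinVar t η m * phaseExp (hq n s) 1) := by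
      rw [map_ellLin]
      simp only [hR, hS, map_sum, map_smul, smul_eq_mul, map_sub, ellLinVar, sum_mul,
        ← sum_add_distrib, mul_sum]
      refine sum_congr rfl fun ε _ => sum_congr rfl fun k _ => ?_
      rw [phaseExp_ellFluct_ellP, Derivation.map_smul, map_smul,
        MvPolynomial.C_eq_smul_one, map_smul]
      simp only [smul_eq_mul]
      ring
    rw [map_smul, h1, smul_eq_mul]
    linear_combination (s * (phaseExp (hq n s) (S n) + ellLinVar t η m * phaseExp (hq n s) 1)) *
      Complex.I_sq
  have hbound : ∀ n, ‖phaseExp (hq n 1) 1 - Complex.exp (-(ellLinVar t η m / 2))‖ ≤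
      (ellL1 (R n) + ellL1 (S n)) * Real.exp ‖ellLinVar t η m‖ * Real.exp ‖ellLinVar t η m‖ := by
    intro n
    refine norm_sub_exp_le_of_hasDerivAt (fun s => hasDerivAt_phaseExp_one (hq n) s) ?_ ?_
    · simp [phaseExp_apply]
    · intro s hs
      rw [hder]
      refine (norm_sub_le _ _).trans (add_le_add ?_ ?_)
      · rw [norm_mul, Complex.norm_I, one_mul]
        exact norm_phaseExp_le _ _
      · rw [norm_mul, Complex.norm_real, Real.norm_eq_abs, abs_of_nonneg hs.1]
        exact (mul_le_of_le_one_left (norm_nonneg _) hs.2.le).trans (norm_phaseExp_le _ _)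
  rw [tendsto_iff_norm_sub_tendsto_zero]
  refine squeeze_zero (fun n => norm_nonneg _) hbound ?_
  simpa using ((Tendsto.add hRn hSn).mul_const (Real.exp ‖ellLinVar t η m‖)).mul_const
    (Real.exp ‖ellLinVar t η m‖)

end CharacteristicFunction

/-! ### From finite-dimensional characteristic functions to the product topology. -/

section ProductConvergence

open Topology

/-- Weak convergence in a countable product follows from the inequality of the portmanteau theorem
for open cylinders. -/
theorem tendsto_probabilityMeasure_of_le_liminf_cylinder {E : Type*} [TopologicalSpace E]
    [MeasurableSpace E] [BorelSpace E] [SecondCountableTopology E]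
    {μ : ℕ → ProbabilityMeasure (ℕ → E)} {ν : ProbabilityMeasure (ℕ → E)}
    (h : ∀ (m : ℕ) (O : Set (Finset.range m → E)), IsOpen O →
      (ν : Measure (ℕ → E)) ((Finset.range m).restrict ⁻¹' O) ≤
        atTop.liminf fun n => (μ n : Measure (ℕ → E)) ((Finset.range m).restrict ⁻¹' O)) :
    Tendsto μ atTop (𝓝 ν) := by
  refine tendsto_of_forall_isOpen_le_liminf' fun G hG => ?_
  -- The largest open base whose cylinder lies in `G`. These cylinders increase to `G`, so
  -- continuity from below reduces the claim to cylinders.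
  let O : (m : ℕ) → Set (Finset.range m → E) := fun m =>
    ⋃₀ {U | IsOpen U ∧ (Finset.range m).restrict ⁻¹' U ⊆ G}
  have hO : ∀ m, IsOpen (O m) := fun m => isOpen_sUnion fun U hU => hU.1
  let C : ℕ → Set (ℕ → E) := fun m => (Finset.range m).restrict ⁻¹' O m
  have hCG : ∀ m, C m ⊆ G := by
    rintro m x ⟨U, hU, hx⟩
    exact hU.2 hx
  have hmono : Monotone C := by
    rintro m m' hmm x ⟨U, hU, hx⟩
    have hsub : Finset.range m ⊆ Finset.range m' := Finset.range_mono hmm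
    refine ⟨Finset.restrict₂ (π := fun _ => E) hsub ⁻¹' U, ⟨hU.1.preimage ?_, hU.2⟩, hx⟩
    exact continuous_pi fun i => continuous_apply _
  have hunion : ⋃ m, C m = G := by
    refine Set.Subset.antisymm (Set.iUnion_subset hCG) fun x hx => ?_
    obtain ⟨I, u, hu, hsub⟩ := isOpen_pi_iff.1 hG x hx
    obtain ⟨m, hm⟩ := I.exists_nat_subset_range
    refine Set.mem_iUnion.2 ⟨m, {y | ∀ i : Finset.range m, (i : ℕ) ∈ I → y i ∈ u i}, ⟨?_, ?_⟩, ?_⟩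
    · simp only [Set.ofPred_forall]
      refine isOpen_iInter_of_finite fun i => isOpen_iInter_of_finite fun hi => ?_
      exact (hu i hi).1.preimage (continuous_apply i)
    · intro y hy
      exact hsub fun i hi => hy ⟨i, hm hi⟩ hi
    · intro i hi
      exact (hu i hi).2
  calc (ν : Measure (ℕ → E)) G = ⨆ m, (ν : Measure (ℕ → E)) (C m) := by
        rw [← hunion, hmono.measure_iUnion]
    _ ≤ _ := iSup_le fun m => (h m (O m) (hO m)).trans
        (liminf_le_liminf (Eventually.of_forall fun n => measure_mono (hCG m)))

/-- Lévy's continuity theorem on each block of `m` coordinates, carried to the Euclidean space `PiLp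
2` where characteristic functions are defined by the inner product. -/
theorem tendsto_infinitePi_of_tendsto_charFun {μ : ℕ → ProbabilityMeasure (ℕ → ℂ)}
    {ν : ℕ → Measure ℂ} [∀ k, IsProbabilityMeasure (ν k)]
    (h : ∀ (m : ℕ) (ξ : ℕ → ℂ), Tendsto (fun n => ∫ x, Complex.exp
      (((∑ k ∈ Finset.range m, inner ℝ (x k) (ξ k) : ℝ) : ℂ) * Complex.I) ∂(μ n : Measure (ℕ → ℂ)))
      atTop (𝓝 (∏ k ∈ Finset.range m, charFun (ν k) (ξ k)))) :
    Tendsto μ atTop (𝓝 ⟨Measure.infinitePi ν, inferInstance⟩) := by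
  refine tendsto_probabilityMeasure_of_le_liminf_cylinder fun m O hO => ?_
  let F := PiLp 2 (fun _ : Finset.range m => ℂ)
  let ρ : (ℕ → ℂ) → F := fun x => WithLp.toLp 2 ((Finset.range m).restrict x)
  have hρ : Measurable ρ := by fun_prop
  have hmap : ∀ κ : Measure (ℕ → ℂ), κ.map ρ =
      (κ.map (Finset.range m).restrict).map (WithLp.toLp 2) := by
    intro κ
    rw [Measure.map_map (by fun_prop) (by fun_prop)]
    rfl
  let κ : ℕ → ProbabilityMeasure F := fun n => (μ n).map hρ.aemeasurable
  let κ₀ : ProbabilityMeasure F :=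
    ProbabilityMeasure.map ⟨Measure.infinitePi ν, inferInstance⟩ hρ.aemeasurable
  have hκ : Tendsto κ atTop (𝓝 κ₀) := by
    refine ProbabilityMeasure.tendsto_of_tendsto_charFun fun s => ?_
    let ξ : ℕ → ℂ := fun k => if hk : k ∈ Finset.range m then s ⟨k, hk⟩ else 0
    have hξ : ∀ k : Finset.range m, ξ k = s k := fun k => by simp only [ξ, dif_pos k.2]
    have e1 : charFun (κ₀ : Measure F) s = ∏ k ∈ Finset.range m, charFun (ν k) (ξ k) := by
      have : (κ₀ : Measure F) = (Measure.infinitePi ν).map ρ := rfl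
      rw [this, hmap, Measure.infinitePi_map_restrict, charFun_pi,
        ← Finset.prod_coe_sort (Finset.range m)]
      simp only [hξ]
    have e2 : ∀ n, charFun (κ n : Measure F) s = ∫ x, Complex.exp
        (((∑ k ∈ Finset.range m, inner ℝ (x k) (ξ k) : ℝ) : ℂ) * Complex.I)
          ∂(μ n : Measure (ℕ → ℂ)) := by
      intro n
      have : (κ n : Measure F) = (μ n : Measure (ℕ → ℂ)).map ρ := rfl
      rw [this, charFun_apply, integral_map hρ.aemeasurable (by fun_prop)]
      refine integral_congr_ae (ae_of_all _ fun x => ?_)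
      simp only
      rw [← Finset.sum_coe_sort]
      simp only [hξ]
      rfl
    rw [e1]
    simp only [e2]
    exact h m ξ
  have hO' : IsOpen ((WithLp.ofLp : F → _) ⁻¹' O) := hO.preimage (PiLp.continuous_ofLp 2 _)
  have := ProbabilityMeasure.le_liminf_measure_open_of_tendsto hκ hO'
  have hm : ∀ κ : Measure (ℕ → ℂ), κ.map ρ ((WithLp.ofLp : F → _) ⁻¹' O) =
      κ ((Finset.range m).restrict ⁻¹' O) := by
    intro κ
    rw [Measure.map_apply hρ hO'.measurableSet]
    rfl
  have e1 : ∀ n, (κ n : Measure F) = (μ n : Measure (ℕ → ℂ)).map ρ := fun n => rfl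
  have e2 : (κ₀ : Measure F) = (Measure.infinitePi ν).map ρ := rfl
  simp only [e1, e2, hm] at this
  exact this

end ProductConvergence

/-! ### Complex Gaussian laws with independent real and imaginary parts. -/

section ComplexGaussian

open scoped NNReal

/-- The law of `x + i y` with `x` and `y` independent centred Gaussian variables of variances `v`
and `w`. -/
noncomputable def complexGaussian (v w : ℝ≥0) : Measure ℂ :=
  ((gaussianReal 0 v).prod (gaussianReal 0 w)).map Complex.equivRealProdCLM.symm

variable (v w : ℝ≥0)

instance isProbabilityMeasure_complexGaussian : IsProbabilityMeasure (complexGaussian v w) :=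
  Measure.isProbabilityMeasure_map (by fun_prop)

instance isGaussian_complexGaussian : IsGaussian (complexGaussian v w) := by
  have h1 : HasGaussianLaw (Prod.fst : ℝ × ℝ → ℝ) ((gaussianReal 0 v).prod (gaussianReal 0 w)) := by
    refine HasLaw.hasGaussianLaw (μ := gaussianReal 0 v) ⟨by fun_prop, ?_⟩
    exact measurePreserving_fst.map_eq
  have h2 : HasGaussianLaw (Prod.snd : ℝ × ℝ → ℝ) ((gaussianReal 0 v).prod (gaussianReal 0 w)) := by
    refine HasLaw.hasGaussianLaw (μ := gaussianReal 0 w) ⟨by fun_prop, ?_⟩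
    exact measurePreserving_snd.map_eq
  have h3 := IndepFun.hasGaussianLaw h1 h2
    (indepFun_prod (X := id) (Y := id) measurable_id measurable_id)
  exact (h3.map_equiv Complex.equivRealProdCLM.symm).isGaussian_map

theorem integral_complexGaussian (f : ℂ → ℂ) (hf : Continuous f) :
    ∫ z, f z ∂complexGaussian v w =
      ∫ p : ℝ × ℝ, f (p.1 + p.2 * Complex.I) ∂(gaussianReal 0 v).prod (gaussianReal 0 w) := by
  rw [complexGaussian, integral_map (by fun_prop) hf.aestronglyMeasurable]
  refine integral_congr_ae (ae_of_all _ fun p => ?_)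
  simp [Complex.equivRealProdCLM_symm_apply]

theorem integral_ofReal_gaussianReal : ∫ x : ℝ, (x : ℂ) ∂gaussianReal 0 v = 0 := by
  rw [integral_complex_ofReal, integral_id_gaussianReal, Complex.ofReal_zero]

theorem integral_ofReal_sq_gaussianReal : ∫ x : ℝ, (x : ℂ) ^ 2 ∂gaussianReal 0 v = v := by
  have h : ∫ x : ℝ, x ^ 2 ∂gaussianReal 0 v = v := by
    rw [← variance_fun_id_gaussianReal (μ := 0), variance_of_integral_eq_zero (by fun_prop)]
    exact integral_id_gaussianReal
  have h2 := integral_complex_ofReal (μ := gaussianReal 0 v) (f := fun x => x ^ 2)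
  rw [h] at h2
  simpa using h2

theorem integrable_ofReal_gaussianReal : Integrable (fun x : ℝ => (x : ℂ)) (gaussianReal 0 v) :=
  (memLp_one_iff_integrable.1 (memLp_id_gaussianReal' 1 (by simp))).ofReal

theorem integrable_ofReal_sq_gaussianReal :
    Integrable (fun x : ℝ => (x : ℂ) ^ 2) (gaussianReal 0 v) := by
  have := (memLp_id_gaussianReal' (μ := 0) (v := v) 2 (by simp)).integrable_sq.ofReal (𝕜 := ℂ)
  simpa using this

theorem integral_id_complexGaussian : ∫ z, z ∂complexGaussian v w = 0 := by
  rw [integral_complexGaussian v w (fun z => z) continuous_id, integral_add]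
  · have h1 := integral_fun_fst (μ := gaussianReal 0 v) (ν := gaussianReal 0 w)
      (fun x : ℝ => (x : ℂ))
    have h2 := integral_fun_snd (μ := gaussianReal 0 v) (ν := gaussianReal 0 w)
      (fun x : ℝ => (x : ℂ) * Complex.I)
    rw [h1, h2, integral_mul_const, integral_ofReal_gaussianReal, integral_ofReal_gaussianReal]
    simp
  · exact (integrable_ofReal_gaussianReal v).comp_fst _
  · exact ((integrable_ofReal_gaussianReal w).mul_const _).comp_snd _

theorem integral_prod_quadratic (a b c : ℂ) :
    ∫ p : ℝ × ℝ, (a * (p.1 : ℂ) ^ 2 + b * (p.2 : ℂ) ^ 2 + c * ((p.1 : ℂ) * (p.2 : ℂ)))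
      ∂(gaussianReal 0 v).prod (gaussianReal 0 w) = a * v + b * w := by
  have h1 := (((integrable_ofReal_sq_gaussianReal v).const_mul a).comp_fst (gaussianReal 0 w))
  have h2 := (((integrable_ofReal_sq_gaussianReal w).const_mul b).comp_snd (gaussianReal 0 v))
  have h3 := ((integrable_ofReal_gaussianReal v).mul_prod
    (integrable_ofReal_gaussianReal w)).const_mul c
  have e1 := integral_fun_fst (μ := gaussianReal 0 v) (ν := gaussianReal 0 w)
      (fun x : ℝ => a * (x : ℂ) ^ 2)
  have e2 := integral_fun_snd (μ := gaussianReal 0 v) (ν := gaussianReal 0 w)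
      (fun x : ℝ => b * (x : ℂ) ^ 2)
  have e3 := integral_prod_mul (μ := gaussianReal 0 v) (ν := gaussianReal 0 w)
      (fun x : ℝ => (x : ℂ)) (fun x : ℝ => (x : ℂ))
  have e0 := integral_add (h1.add h2) h3
  simp only [Pi.add_apply] at e0
  rw [e0, integral_add h1 h2, e1, e2, integral_const_mul c, e3]
  simp [integral_const_mul, integral_ofReal_sq_gaussianReal, integral_ofReal_gaussianReal]

theorem integral_sq_complexGaussian : ∫ z, z ^ 2 ∂complexGaussian v w = (v : ℂ) - (w : ℂ) := by
  rw [integral_complexGaussian v w (fun z => z ^ 2) (by fun_prop)]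
  have := integral_prod_quadratic v w 1 (-1) (2 * Complex.I)
  rw [one_mul, neg_one_mul, ← sub_eq_add_neg] at this
  rw [← this]
  refine integral_congr_ae (ae_of_all _ fun p => ?_)
  simp only
  linear_combination (p.2 : ℂ) ^ 2 * Complex.I_sq

theorem integral_norm_sq_complexGaussian : ∫ z, ‖z‖ ^ 2 ∂complexGaussian v w = (v : ℝ) + w := by
  have h : ∫ z, ((‖z‖ ^ 2 : ℝ) : ℂ) ∂complexGaussian v w = ((v : ℝ) + w : ℝ) := by
    rw [integral_complexGaussian v w (fun z => ((‖z‖ ^ 2 : ℝ) : ℂ)) (by fun_prop)]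
    have := integral_prod_quadratic v w 1 1 0
    push_cast at this ⊢
    rw [one_mul, one_mul] at this
    rw [← this]
    refine integral_congr_ae (ae_of_all _ fun p => ?_)
    simp only
    rw [← Complex.ofReal_pow, Complex.sq_norm, Complex.normSq_add_mul_I]
    push_cast
    ring
  rw [integral_complex_ofReal] at h
  exact_mod_cast h

theorem charFun_complexGaussian (ξ : ℂ) : charFun (complexGaussian v w) ξ =
    Complex.exp (-(v * (ξ.re : ℂ) ^ 2 + w * (ξ.im : ℂ) ^ 2) / 2) := by
  have h1 := charFun_gaussianReal (μ := 0) (v := v) ξ.re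
  have h2 := charFun_gaussianReal (μ := 0) (v := w) ξ.im
  rw [charFun_apply_real] at h1 h2
  rw [charFun_apply, integral_complexGaussian v w
    (fun z => Complex.exp ((inner ℝ z ξ : ℝ) * Complex.I)) (by fun_prop)]
  have e3 := integral_prod_mul (μ := gaussianReal 0 v) (ν := gaussianReal 0 w)
    (fun x : ℝ => Complex.exp (ξ.re * x * Complex.I))
    (fun x : ℝ => Complex.exp (ξ.im * x * Complex.I))
  rw [h1, h2, ← Complex.exp_add] at e3
  rw [show -(v * (ξ.re : ℂ) ^ 2 + w * (ξ.im : ℂ) ^ 2) / 2 =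
    ξ.re * (0 : ℝ) * Complex.I - v * ξ.re ^ 2 / 2 + (ξ.im * (0 : ℝ) * Complex.I - w * ξ.im ^ 2 / 2)
    by push_cast; ring, ← e3]
  refine integral_congr_ae (ae_of_all _ fun p => ?_)
  simp only [← Complex.exp_add, Complex.inner]
  congr 1
  simp
  ring

end ComplexGaussian

/-! ### Realisation of the ensemble by polynomials in the Gaussian variables. -/

section Realization

open Finset Topology

variable {t : ℝ}

/-- The elliptic Ginibre matrix as a function of the Gaussian variables. -/
noncomputable def ellSample (t : ℝ) (n : ℕ) (g : EllIndex n → ℝ) : Matrix (Fin n) (Fin n) ℂ :=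
  ellipticCombination n t (gueMatrix n fun p => g (Sum.inl p), gueMatrix n fun p => g (Sum.inr p))

theorem measurePreserving_ellSample (t : ℝ) (n : ℕ) :
    MeasurePreserving (ellSample t n) (stdGaussianPi (EllIndex n)) (ellipticGinibreLaw n t) := by
  have h1 := measurePreserving_sumPiEquivProdPi (ι := Fin n × Fin n) (ι' := Fin n × Fin n)
    (X := fun _ => ℝ) (fun _ => gaussianReal 0 1)
  have hg : MeasurePreserving (gueMatrix n) (Measure.pi fun _ => gaussianReal 0 1) (gueLaw n) :=
    ⟨measurable_gueMatrix n, rfl⟩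
  have h3 : MeasurePreserving (ellipticCombination n t) ((gueLaw n).prod (gueLaw n))
      (ellipticGinibreLaw n t) := ⟨measurable_ellipticCombination n t, rfl⟩
  exact h3.comp ((hg.prod hg).comp h1)

theorem realEval_ellMatrix_true (t : ℝ) (n : ℕ) (g : EllIndex n → ℝ) :
    (ellMatrix t true n).map (realEval g) = (√n : ℂ)⁻¹ • ellSample t n g := by
  ext i j
  simp only [Matrix.map_apply, ellMatrix, Matrix.of_apply, map_add, map_sum, map_mul, realEval_C,
    realEval_X, Matrix.smul_apply, ellSample, ellipticCombination, Matrix.add_apply,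
    gueMatrix_apply_eq_sum, Fintype.sum_sum_type, ellCoeff, Sum.elim_inl, Sum.elim_inr,
    smul_eq_mul, mul_add, mul_sum, if_true]
  congr 1 <;> exact sum_congr rfl fun p _ => by ring

theorem traceStat_ellSample (t : ℝ) (n k : ℕ) (g : EllIndex n → ℝ) :
    traceStat n t k (ellSample t n g) = realEval g (ellP t true k n).trace +
      if k = 2 then (n : ℂ) * (t : ℂ) else 0 := by
  rw [traceStat, ← realEval_ellMatrix_true, modChebyshev, ellP]
  congr 1
  have := Polynomial.aeval_algHom_apply (realEval g).mapMatrix (ellMatrix t true n)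
    (Polynomial.dickson 1 (t : ℂ) k)
  rw [AlgHom.mapMatrix_apply] at this
  rw [this, AlgHom.mapMatrix_apply]
  simp [Matrix.trace]

theorem measurable_traceStat (n : ℕ) (t : ℝ) (k : ℕ) : Measurable (traceStat n t k) := by
  have hentry : ∀ i j, Measurable fun M : Matrix (Fin n) (Fin n) ℂ => M i j := fun i j =>
    (measurable_pi_apply j).comp (measurable_pi_apply i)
  have hpow : ∀ (m : ℕ) (i j : Fin n), Measurable fun M : Matrix (Fin n) (Fin n) ℂ =>
      (((√n : ℂ)⁻¹ • M) ^ m) i j := by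
    intro m
    induction m with
    | zero => intro i j; simp
    | succ m ih =>
      intro i j
      simp only [pow_succ, Matrix.mul_apply, Matrix.smul_apply, smul_eq_mul]
      exact Finset.measurable_fun_sum _ fun s _ => (ih i s).mul ((hentry s j).const_mul _)
  unfold traceStat
  refine Measurable.add_const ?_ _
  simp only [Polynomial.aeval_eq_sum_range, Matrix.trace, Matrix.diag_apply, Matrix.sum_apply,
    Matrix.smul_apply, smul_eq_mul]
  exact Finset.measurable_fun_sum _ fun i _ => Finset.measurable_fun_sum _ fun m _ =>
    (hpow m i i).const_mul _

theorem integrable_traceStat (t : ℝ) (n k : ℕ) :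
    Integrable (traceStat n t k) (ellipticGinibreLaw n t) := by
  have hm := measurePreserving_ellSample t n
  rw [← hm.integrable_comp (measurable_traceStat n t k).aestronglyMeasurable]
  have : traceStat n t k ∘ ellSample t n = fun g => realEval g (ellP t true k n).trace +
      if k = 2 then (n : ℂ) * (t : ℂ) else 0 := funext (traceStat_ellSample t n k)
  rw [this]
  exact (integrable_realEval _).add (integrable_const _)

/-- The centred trace statistics as a function of the matrix. -/
noncomputable def traceFluct (t : ℝ) (n : ℕ) (M : Matrix (Fin n) (Fin n) ℂ) (k : ℕ) : ℂ :=
  traceStat n t k M - ∫ M', traceStat n t k M' ∂ellipticGinibreLaw n t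

theorem measurable_traceFluct (t : ℝ) (n : ℕ) : Measurable (traceFluct t n) :=
  measurable_pi_lambda _ fun k => (measurable_traceStat n t k).sub_const _

/-- The shift `n t` in degree two is deterministic and cancels against its own expectation. -/
theorem traceFluct_ellSample (t : ℝ) (n k : ℕ) (g : EllIndex n → ℝ) :
    traceFluct t n (ellSample t n g) k = realEval g (ellFluct (ellP t true k) n) := by
  have hm := measurePreserving_ellSample t n
  have h : ∫ M', traceStat n t k M' ∂ellipticGinibreLaw n t = ellE (ellP t true k n).trace +
      if k = 2 then (n : ℂ) * (t : ℂ) else 0 := by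
    rw [← hm.map_eq, integral_map hm.aemeasurable
      (measurable_traceStat n t k).aestronglyMeasurable]
    simp only [traceStat_ellSample]
    rw [integral_add (integrable_realEval _) (integrable_const _), ellE_apply]
    simp
  rw [traceFluct, h, traceStat_ellSample, ellFluct, ellCen_apply, map_sub, realEval_C]
  ring

/-- As `t` is real, the adjoint only exchanges the letter. Conjugate traces, hence real linear forms
in the traces, are therefore combinations of both letters. -/
theorem ellStar_ellP (t : ℝ) (ε : Bool) (k : ℕ) : ellStar (ellP t ε k) = ellP t (!ε) k := by
  funext n
  have hX : ((ellMatrix t ε n).map ellConj).transpose = ellMatrix t (!ε) n := by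
    ext1 i j
    exact map_conj_ellMatrix t ε j i
  have hs : ∀ (a : ℝ) (Z : Matrix (Fin n) (Fin n) (EllPoly n)),
      (((a : ℂ) • Z).map ellConj).transpose = (a : ℂ) • (Z.map ellConj).transpose := by
    intro a Z
    ext1 i j
    simp only [Matrix.transpose_apply, Matrix.map_apply, Matrix.smul_apply,
      MvPolynomial.smul_eq_C_mul, map_mul, MvPolynomial.map_C, Complex.conj_ofReal]
  induction k using Nat.twoStepInduction with
  | zero =>
    have h : ∀ ε, ellP t ε 0 n = ((2 : ℝ) : ℂ) • 1 := by
      intro ε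
      have h : (3 - (1 : ℕ) : Polynomial ℂ) = Polynomial.C 2 := by
        rw [map_ofNat]; norm_num
      rw [ellP, Polynomial.dickson_zero, h, Polynomial.aeval_C, Algebra.algebraMap_eq_smul_one,
        Complex.ofReal_ofNat]
    rw [ellStar, h, h, hs, Matrix.map_one _ (map_zero _) (map_one _), Matrix.transpose_one]
  | one => simpa [ellStar, ellP] using hX
  | more k h0 h1 =>
    have e : ∀ ε, ellP t ε (k + 2) n = ellMatrix t ε n * ellP t ε (k + 1) n -
        (t : ℂ) • ellP t ε k n := by
      intro ε
      simp [ellP, Polynomial.dickson_add_two, ← Algebra.smul_def]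
    have e' : ∀ ε, ellP t ε (k + 1) n * ellMatrix t ε n = ellMatrix t ε n * ellP t ε (k + 1) n := by
      intro ε
      have := Polynomial.aeval_mul (ellMatrix t ε n) (p := Polynomial.dickson 1 (t : ℂ) (k + 1))
        (q := Polynomial.X)
      rw [mul_comm, map_mul, Polynomial.aeval_X] at this
      exact this.symm
    have hsub : ((ellMatrix t ε n * ellP t ε (k + 1) n -
        (t : ℂ) • ellP t ε k n).map ellConj).transpose =
        ((ellP t ε (k + 1) n).map ellConj).transpose * ((ellMatrix t ε n).map ellConj).transpose -
          (t : ℂ) • ((ellP t ε k n).map ellConj).transpose := by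
      rw [← hs, ← Matrix.transpose_mul, ← Matrix.map_mul, ← Matrix.transpose_sub]
      congr 1
      exact Matrix.map_sub _ (map_sub _) _ _
    rw [ellStar] at h0 h1 ⊢
    rw [e, hsub, h0, h1, hX, e', ← e]

/-- The coefficients of the real linear form `∑ Re (x k * conj (ξ k))`. -/
noncomputable def dualCoeff (ξ : ℕ → ℂ) (ε : Bool) (k : ℕ) : ℂ :=
  if ε then starRingEnd ℂ (ξ (k + 1)) / 2 else ξ (k + 1) / 2

theorem realEval_ellLin_dualCoeff (ξ : ℕ → ℂ) (m n : ℕ) (g : EllIndex n → ℝ) :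
    realEval g (ellLin t (dualCoeff ξ) m n) = ((∑ k ∈ range m,
      inner ℝ (realEval g (ellFluct (ellP t true (k + 1)) n)) (ξ (k + 1)) : ℝ) : ℂ) := by
  have hc : ∀ k, realEval g (ellFluct (ellP t false k) n) =
      starRingEnd ℂ (realEval g (ellFluct (ellP t true k) n)) := by
    intro k
    rw [conj_realEval, ellConj_ellFluct, ellStar_ellP]
    rfl
  simp only [ellLin, Fintype.sum_bool, map_add, map_sum, map_smul, hc, dualCoeff, smul_eq_mul,
    Complex.inner, ← sum_add_distrib, if_true, Complex.ofReal_sum]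
  refine sum_congr rfl fun k _ => ?_
  rw [Complex.re_eq_add_conj]
  simp
  ring

theorem isPhase_ellLin_dualCoeff (t : ℝ) (ξ : ℕ → ℂ) (m n : ℕ) (s : ℝ) :
    IsPhase ((Complex.I * s) • ellLin t (dualCoeff ξ) m n) := by
  intro g
  rw [map_smul, realEval_ellLin_dualCoeff, smul_eq_mul, mul_assoc, ← Complex.ofReal_mul]
  simp

theorem ellFluct_ellP_zero (t : ℝ) (ε : Bool) (n : ℕ) : ellFluct (ellP t ε 0) n = 0 := by
  have : (ellP t ε 0 n).trace = MvPolynomial.C (2 * n : ℂ) := by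
    have h : (3 - (1 : ℕ) : Polynomial ℂ) = Polynomial.C 2 := by
      rw [map_ofNat]; norm_num
    rw [ellP, Polynomial.dickson_zero, h, Polynomial.aeval_C, Algebra.algebraMap_eq_smul_one,
      Matrix.trace_smul, Matrix.trace_one, MvPolynomial.smul_eq_C_mul]
    simp
  rw [ellFluct, this, ellCen_C]

/-- The variance of the real part of the limiting Gaussian variable. -/
noncomputable def limVarRe (t : ℝ) (k : ℕ) : NNReal := (k * (1 + t ^ k) / 2).toNNReal

/-- The variance of the imaginary part of the limiting Gaussian variable. -/
noncomputable def limVarIm (t : ℝ) (k : ℕ) : NNReal := (k * (1 - t ^ k) / 2).toNNReal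

theorem coe_limVarRe (ht : t ∈ Set.Icc (0 : ℝ) 1) (k : ℕ) :
    (limVarRe t k : ℝ) = k * (1 + t ^ k) / 2 := by
  have := pow_nonneg ht.1 k
  exact Real.coe_toNNReal _ (by positivity)

theorem coe_limVarIm (ht : t ∈ Set.Icc (0 : ℝ) 1) (k : ℕ) :
    (limVarIm t k : ℝ) = k * (1 - t ^ k) / 2 := by
  have : 0 ≤ 1 - t ^ k := sub_nonneg.2 (pow_le_one₀ ht.1 ht.2)
  exact Real.coe_toNNReal _ (by positivity)

/-- The variance is a sum over degrees. With `ξ = x + i y`, degree `d` contributes `d (t ^ d (ξ ^ 2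
+ conj ξ ^ 2) + 2 |ξ| ^ 2) / 4`, which equals `d ((1 + t ^ d) x ^ 2 + (1 - t ^ d) y ^ 2) / 2`. -/
theorem exp_ellLinVar_dualCoeff (ht : t ∈ Set.Icc (0 : ℝ) 1) (ξ : ℕ → ℂ) (m : ℕ) :
    Complex.exp (-(ellLinVar t (dualCoeff ξ) m / 2)) =
      ∏ k ∈ range m, charFun (complexGaussian (limVarRe t (k + 1)) (limVarIm t (k + 1)))
        (ξ (k + 1)) := by
  simp only [charFun_complexGaussian, ← Complex.exp_sum]
  congr 1
  rw [ellLinVar, Fintype.sum_bool, ← sum_add_distrib, sum_div, ← sum_neg_distrib]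
  refine sum_congr rfl fun k _ => ?_
  have h1 : ((limVarRe t (k + 1) : ℝ) : ℂ) = (k + 1) * (1 + t ^ (k + 1)) / 2 := by
    rw [coe_limVarRe ht]; push_cast; ring
  have h2 : ((limVarIm t (k + 1) : ℝ) : ℂ) = (k + 1) * (1 - t ^ (k + 1)) / 2 := by
    rw [coe_limVarIm ht]; push_cast; ring
  rw [h1, h2]
  obtain ⟨z, hz⟩ : ∃ z, ξ (k + 1) = z := ⟨_, rfl⟩
  have e1 : z = z.re + z.im * Complex.I := (Complex.re_add_im z).symm
  have e2 : starRingEnd ℂ z = z.re - z.im * Complex.I :=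
    Complex.ext (by simp) (by simp)
  simp only [ellLinCov, Fintype.sum_bool, dualCoeff, hz, ellCov, e2, if_true]
  rw [if_neg (by simp), if_neg (by simp), if_neg (by simp)]
  generalize hx : (z.re : ℂ) = x at *
  generalize hy : (z.im : ℂ) = y at *
  rw [e1, one_pow]
  linear_combination (-(((k : ℂ) + 1) * y ^ 2 / 4) * (t ^ (k + 1) - 1)) * Complex.I_sq

end Realization

/-! ### Assembly of the theorem. -/

theorem mainTheorem6 (t : ℝ) (ht : t ∈ Set.Icc (0 : ℝ) 1)
    {Ω : ℕ → Type*} [∀ n, MeasurableSpace (Ω n)]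
    (P : (n : ℕ) → Measure (Ω n)) [∀ n, IsProbabilityMeasure (P n)]
    (A : (n : ℕ) → Ω n → Matrix (Fin n) (Fin n) ℂ)
    (hA : ∀ n, HasLaw (A n) (ellipticGinibreLaw n t) (P n)) :
    (∀ n k, Integrable (fun ω => traceStat n t k (A n ω)) (P n)) ∧
    ∃ (Ω' : Type) (_ : MeasurableSpace Ω') (P' : Measure Ω') (_ : IsProbabilityMeasure P')
      (V : ℕ → Ω' → ℂ),
      iIndepFun V P' ∧
      (∀ k, HasGaussianLaw (V k) P') ∧
      (∀ k, ∫ ω, V k ω ∂P' = 0) ∧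
      (∀ k, ∫ ω, V k ω ^ 2 ∂P' = (k : ℂ) * (t : ℂ) ^ k) ∧
      (∀ k, ∫ ω, ‖V k ω‖ ^ 2 ∂P' = (k : ℝ)) ∧
      TendstoInDistribution (E := ℕ → ℂ)
        (fun n ω k => centredTrace (P n) n t (A n) k ω) atTop (fun ω k => V k ω) P P' := by
  -- The two variances are the solution of `v - w = k t ^ k` and `v + w = k`, the prescribed values
  -- of `E [V ^ 2]` and `E |V| ^ 2`.
  let ν : ℕ → Measure ℂ := fun k => complexGaussian (limVarRe t k) (limVarIm t k)
  have hν : ∀ k, (Measure.infinitePi ν).map (fun ω : ℕ → ℂ => ω k) = ν k :=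
    fun k => (measurePreserving_eval_infinitePi ν k).map_eq
  have hcen : ∀ n, (fun ω k => centredTrace (P n) n t (A n) k ω) = traceFluct t n ∘ A n := by
    intro n
    funext ω k
    simp only [centredTrace, Function.comp_apply, traceFluct]
    rw [← (hA n).map_eq, integral_map (hA n).aemeasurable
      (measurable_traceStat n t k).aestronglyMeasurable]
  refine ⟨fun n k => ?_, ℕ → ℂ, inferInstance, Measure.infinitePi ν, inferInstance,
    fun k ω => ω k, ?_, fun k => ?_, fun k => ?_, fun k => ?_, fun k => ?_, ?_⟩
  · have := integrable_traceStat t n k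
    rw [← (hA n).map_eq] at this
    exact this.comp_aemeasurable (hA n).aemeasurable
  · exact iIndepFun_infinitePi (X := fun _ z => z) fun _ => measurable_id
  · exact HasLaw.hasGaussianLaw (μ := ν k) ⟨(measurable_pi_apply k).aemeasurable, hν k⟩
  · have := integral_map (μ := Measure.infinitePi ν) (φ := fun ω : ℕ → ℂ => ω k)
      (f := fun z => z) (measurable_pi_apply k).aemeasurable (by fun_prop)
    rw [← this, hν, integral_id_complexGaussian]
  · have := integral_map (μ := Measure.infinitePi ν) (φ := fun ω : ℕ → ℂ => ω k)
      (f := fun z => z ^ 2) (measurable_pi_apply k).aemeasurable (by fun_prop)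
    rw [← this, hν, integral_sq_complexGaussian]
    have h1 : ((limVarRe t k : ℝ) : ℂ) - ((limVarIm t k : ℝ) : ℂ) = (k : ℂ) * (t : ℂ) ^ k := by
      rw [coe_limVarRe ht, coe_limVarIm ht]; push_cast; ring
    exact h1
  · have := integral_map (μ := Measure.infinitePi ν) (φ := fun ω : ℕ → ℂ => ω k)
      (f := fun z => ‖z‖ ^ 2) (measurable_pi_apply k).aemeasurable (by fun_prop)
    rw [← this, hν, integral_norm_sq_complexGaussian, coe_limVarRe ht, coe_limVarIm ht]
    ring
  · have hmeas : ∀ n, AEMeasurable (fun ω k => centredTrace (P n) n t (A n) k ω) (P n) := by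
      intro n
      rw [hcen]
      exact (measurable_traceFluct t n).comp_aemeasurable (hA n).aemeasurable
    have hlaw : ∀ n, (P n).map (fun ω k => centredTrace (P n) n t (A n) k ω) =
        (stdGaussianPi (EllIndex n)).map fun g k => realEval g (ellFluct (ellP t true k) n) := by
      intro n
      have hm := measurePreserving_ellSample t n
      rw [hcen, ← AEMeasurable.map_map_of_aemeasurable (measurable_traceFluct t n).aemeasurable
        (hA n).aemeasurable, (hA n).map_eq, ← hm.map_eq,
        Measure.map_map (measurable_traceFluct t n) hm.measurable]
      congr 1
      funext g k
      exact traceFluct_ellSample t n k g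
    refine ⟨hmeas, measurable_id.aemeasurable, ?_⟩
    have key := tendsto_infinitePi_of_tendsto_charFun (ν := ν)
      (μ := fun n => ⟨(P n).map (fun ω k => centredTrace (P n) n t (A n) k ω),
        Measure.isProbabilityMeasure_map (hmeas n)⟩) ?_
    · convert key using 2
      exact congrArg nhds (Subtype.ext Measure.map_id)
    · intro m ξ
      have hint : ∀ n, ∫ x : ℕ → ℂ, Complex.exp (((∑ k ∈ Finset.range m,
          inner ℝ (x k) (ξ k) : ℝ) : ℂ) * Complex.I)
          ∂(P n).map (fun ω k => centredTrace (P n) n t (A n) k ω) =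
          ∫ g, Complex.exp (((∑ k ∈ Finset.range m, inner ℝ
            (realEval g (ellFluct (ellP t true k) n)) (ξ k) : ℝ) : ℂ) * Complex.I)
            ∂stdGaussianPi (EllIndex n) := by
        intro n
        rw [hlaw, integral_map]
        · refine (measurable_pi_lambda _ fun k => ?_).aemeasurable
          exact (continuous_realEval _).measurable
        · refine Measurable.aestronglyMeasurable ?_
          refine Complex.measurable_exp.comp (Measurable.mul_const (Complex.measurable_ofReal.comp
            (Finset.measurable_fun_sum _ fun k _ => ?_)) _)
          exact Measurable.inner (measurable_pi_apply k) measurable_const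
      simp only [ProbabilityMeasure.coe_mk, hint]
      -- Degree zero is split off: its centred trace vanishes and its limit law is a point mass at
      -- `0`. The linear forms `ellLin` start at degree one.
      cases m with
      | zero => simp
      | succ m =>
        have h0 : charFun (ν 0) (ξ 0) = 1 := by
          simp [ν, charFun_complexGaussian, limVarRe, limVarIm]
        rw [Finset.prod_range_succ', h0, mul_one, ← exp_ellLinVar_dualCoeff ht]
        refine (tendsto_phaseExp_ellLin ht (dualCoeff ξ) m
          (isPhase_ellLin_dualCoeff t ξ m)).congr fun n => ?_
        rw [phaseExp_apply]
        refine integral_congr_ae (ae_of_all _ fun g => ?_)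
        simp only [map_one, one_mul, map_smul, realEval_ellLin_dualCoeff, smul_eq_mul,
          Finset.sum_range_succ' _ m, ellFluct_ellP_zero, map_zero, inner_zero_left, add_zero,
          Complex.ofReal_one, mul_one]
        rw [mul_comm]
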